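/- Let $\mathbb F$ be a non-archimedean local field of characteristic $0$, with a fixed uniformizer $\varpi$. Let $\underline G$ be a connected reductive linear algebraic group defined over $\mathbb F$, $\sigma$ an involution of $\underline G$ defined over $\mathbb F$, and $\underline H$ an open subgroup, defined over $\mathbb F$, of the group of fixed points of $\sigma$; put $G=\underline G(\mathbb F)$, $H=\underline H(\mathbb F)$. For a split torus $A$ of $G$ let $\Lambda(A)$ be the set of the elements $c(\varpi)\in A$, where $c$ runs through the one-parameter subgroups of $A$. For $\lambda\in\Lambda(A)$ put $$P_\lambda=\{g\in G : (\lambda^{-n}g\lambda^n)_{n\in\mathbb N}\text{ is bounded}\},\quad M_\lambda=\{g\in G:\lambda^{-1}g\lambda=g\},\quad U_\lambda=\{g\in G:\lambda^{-n}g\lambda^n\to e\};$$ $P_\lambda$ is a parabolic subgroup of $G$ with Levi subgroup $M_\lambda$ and unipotent radical $U_\lambda$, and every parabolic subgroup containing a given maximal split torus $A$ is of the form $P_\lambda$ with $\lambda \in\Lambda(A)$. Let $A$ be a $\sigma$-stable maximal split torus of $G$, let $\lambda\in\Lambda(A)$, and put $P=P_\lambda$, $M=M_\lambda$, $U=U_\lambda$,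 $\mu=\lambda\sigma(\lambda)$, and $V=U_\mu$, the unipotent radical of $P_\mu$. Let $V'=(P\cap\sigma(P))\cap V$. Then: (i) $P\cap\sigma(P)=(M\cap\sigma(M))V'$; moreover $V'$ is normal in $P\cap\sigma(P)$ and $V'\cap(M\cap\sigma(M))=\{e\}$. (ii) $V'=(M\cap\sigma(U))(U\cap\sigma(P))$ and $U\cap\sigma(P)=(U\cap\sigma(M))(U\cap\sigma(U))$, where $U\cap\sigma(P)$ is normal in $V'$ and $U\cap\sigma(U)$ is normal in $U\cap\sigma(P)$. (iii) $P\cap H=(M\cap\sigma(M)\cap H)(V'\cap H)$, where $V'\cap H$ is normal in $P\cap H$. (iv) For every $x\in M\cap\sigma(U)$ there are $h\in H\cap V'$ and $y\in U\cap\sigma(P)$ such that $x=hy$. -/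

import Mathlib

open scoped Matrix MatrixGroups Pointwise Topology
open Matrix Filter

noncomputable section

namespace RedSym

/-! ### Linear algebraic groups

A linear algebraic group defined over a field `F` of characteristic zero is given by its points
over an algebraic closure of `F`, as a subgroup of some `GL_n` which is the zero set of polynomials
with coefficients in `F` in the matrix entries and the inverse of the determinant.  As `F` is
perfect, being cut out by polynomials over `F` is the same as being defined over `F`. -/

section AlgebraicGroups

/-- The coordinates of a point of `GL_n`: the matrix entries and the inverse of the determinant. -/
def coord {L : Type*} [Field L] {n : ℕ} (g : GL (Fin n) L) : Option (Fin n × Fin n) → L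
  | none => (g : Matrix (Fin n) (Fin n) L).det⁻¹
  | some ij => (g : Matrix (Fin n) (Fin n) L) ij.1 ij.2

/-- The value at a point of `GL_n(L)` of a regular function on `GL_n` with coefficients in `k`. -/
def evalAt {k L : Type*} [Field k] [Field L] [Algebra k L] {n : ℕ} (g : GL (Fin n) L)
    (p : MvPolynomial (Option (Fin n × Fin n)) k) : L :=
  MvPolynomial.aeval (coord g) p

/-- `Z` is Zariski closed in `GL_n(L)`, with equations having coefficients in `k`. -/
def IsZariskiClosed (k : Type*) {L : Type*} [Field k] [Field L] [Algebra k L] {n : ℕ}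
    (Z : Set (GL (Fin n) L)) : Prop :=
  ∃ I : Set (MvPolynomial (Option (Fin n × Fin n)) k), Z = {g | ∀ p ∈ I, evalAt g p = 0}

/-- `S` is connected for the Zariski topology (`S` is meant to be nonempty). -/
def IsZariskiConnected {L : Type*} [Field L] {n : ℕ} (S : Set (GL (Fin n) L)) : Prop :=
  ∀ Z₁ Z₂ : Set (GL (Fin n) L), IsZariskiClosed L Z₁ → IsZariskiClosed L Z₂ →
    S ⊆ Z₁ ∪ Z₂ → S ∩ Z₁ ∩ Z₂ = ∅ → S ⊆ Z₁ ∨ S ⊆ Z₂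

/-- All elements of `N` are unipotent matrices. -/
def IsUnipotentGroup {L : Type*} [Field L] {n : ℕ} (N : Subgroup (GL (Fin n) L)) : Prop :=
  ∀ g ∈ N, IsNilpotent ((g : Matrix (Fin n) (Fin n) L) - 1)

/-- `N` is a subgroup of `K`, normal in `K`. -/
def IsNormalIn {Γ : Type*} [Group Γ] (N K : Subgroup Γ) : Prop :=
  N ≤ K ∧ (N.subgroupOf K).Normal

/-- The unipotent radical of `G` is trivial: every Zariski closed, connected, normal, unipotent
subgroup is trivial.  Here `L` is meant to be algebraically closed. -/
def IsReductive {L : Type*} [Field L] {n : ℕ} (G : Subgroup (GL (Fin n) L)) : Prop :=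
  ∀ N : Subgroup (GL (Fin n) L), IsZariskiClosed L (N : Set (GL (Fin n) L)) →
    IsZariskiConnected (N : Set (GL (Fin n) L)) → IsNormalIn N G → IsUnipotentGroup N → N = ⊥

/-- A homomorphism between linear algebraic groups which is a morphism of varieties defined over
`k`: the entries of the image are regular functions with coefficients in `k`. -/
def IsRegularOver (k : Type*) {L : Type*} [Field k] [Field L] [Algebra k L] {n m : ℕ}
    {S : Subgroup (GL (Fin n) L)} {T : Subgroup (GL (Fin m) L)} (φ : S →* T) : Prop :=
  ∃ p : Fin m → Fin m → MvPolynomial (Option (Fin n × Fin n)) k,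
    ∀ (g : S) (i j : Fin m), (φ g : GL (Fin m) L) i j = evalAt (g : GL (Fin n) L) (p i j)

/-- The inclusion `GL_n(F) → GL_n(L)`. -/
abbrev baseChange (F L : Type*) [Field F] [Field L] [Algebra F L] (n : ℕ) :
    GL (Fin n) F →* GL (Fin n) L :=
  Matrix.GeneralLinearGroup.map (algebraMap F L)

/-- The group of `F`-points of a subgroup of `GL_n`. -/
def points (F : Type*) {L : Type*} [Field F] [Field L] [Algebra F L] {n : ℕ}
    (S : Subgroup (GL (Fin n) L)) : Subgroup (GL (Fin n) F) :=
  S.comap (baseChange F L n)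

/-- The diagonal torus of `GL_r`, a product of `r` copies of the multiplicative group. -/
def diagTorus (L : Type*) [Field L] (r : ℕ) : Subgroup (GL (Fin r) L) where
  carrier := {g | (g : Matrix (Fin r) (Fin r) L).IsDiag}
  one_mem' := by simp [Matrix.isDiag_one]
  mul_mem' := by
    intro a b ha hb i j hij
    simp only [Set.mem_ofPred_eq] at ha hb
    simp only [Units.val_mul, Matrix.mul_apply]
    refine Finset.sum_eq_zero fun k _ => ?_
    by_cases h : i = k
    · subst h
      rw [hb hij, mul_zero]
    · rw [ha h, zero_mul]
  inv_mem' := by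
    intro a ha
    simp only [Set.mem_ofPred_eq] at ha ⊢
    rw [Matrix.coe_units_inv]
    rw [← (Matrix.isDiag_iff_diagonal_diag _).mp ha, Matrix.inv_diagonal]
    exact Matrix.isDiag_diagonal _

/-- A torus defined and split over `k`: a closed subgroup defined over `k` and isomorphic over `k`
to a product of copies of the multiplicative group. -/
def IsSplitTorus (k : Type*) {L : Type*} [Field k] [Field L] [Algebra k L] {n : ℕ}
    (A : Subgroup (GL (Fin n) L)) : Prop :=
  IsZariskiClosed k (A : Set (GL (Fin n) L)) ∧
    ∃ (r : ℕ) (e : diagTorus L r ≃* A),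
      IsRegularOver k e.toMonoidHom ∧ IsRegularOver k e.symm.toMonoidHom

/-- A maximal split torus of `G`. -/
def IsMaximalSplitTorus (k : Type*) {L : Type*} [Field k] [Field L] [Algebra k L] {n : ℕ}
    (A G : Subgroup (GL (Fin n) L)) : Prop :=
  IsSplitTorus k A ∧ A ≤ G ∧
    ∀ B : Subgroup (GL (Fin n) L), IsSplitTorus k B → B ≤ G → A ≤ B → B = A

/-- The elements of `A(F)` of the form `c(ϖ)`, where `c` runs through the one-parameter subgroups
of `A` defined over `F`. -/
def cocharacterValues {F : Type*} (L : Type*) [Field F] [Field L] [Algebra F L] {n : ℕ} (ϖ : Fˣ)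
    (A : Subgroup (GL (Fin n) L)) : Set (GL (Fin n) F) :=
  {l | ∃ c : (⊤ : Subgroup (GL (Fin 1) L)) →* A, IsRegularOver F c ∧
    baseChange F L n l =
      c ⟨baseChange F L 1 (Matrix.GeneralLinearGroup.scalar (Fin 1) ϖ), Subgroup.mem_top _⟩}

variable {F L : Type*} [Field F] [Field L] [Algebra F L] {n : ℕ}

theorem baseChange_injective (n : ℕ) : Function.Injective (baseChange F L n) := by
  intro a b h
  ext i j
  have := congrArg (fun g : GL (Fin n) L => g i j) h
  simpa using this

theorem coord_baseChange (g : GL (Fin n) F) :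
    coord (baseChange F L n g) = fun x => algebraMap F L (coord g x) := by
  funext x
  cases x with
  | none =>
    have : ((baseChange F L n g : GL (Fin n) L) : Matrix (Fin n) (Fin n) L) =
        (algebraMap F L).mapMatrix (g : Matrix (Fin n) (Fin n) F) := rfl
    simp only [coord, this, ← RingHom.map_det, map_inv₀]
  | some ij => simp [coord]

theorem evalAt_baseChange (g : GL (Fin n) F) (p : MvPolynomial (Option (Fin n × Fin n)) F) :
    evalAt (baseChange F L n g) p = algebraMap F L (evalAt g p) := by
  simp only [evalAt, coord_baseChange]
  exact MvPolynomial.aeval_algebraMap_apply _ _ _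

theorem exists_points_map {m : ℕ} {S : Subgroup (GL (Fin n) L)} {T : Subgroup (GL (Fin m) L)}
    {φ : S →* T} (hφ : IsRegularOver F φ) (g : points F S) :
    ∃ g' : points F T, baseChange F L m g' = φ ⟨baseChange F L n g, g.2⟩ := by
  obtain ⟨p, hp⟩ := hφ
  let N : Matrix (Fin m) (Fin m) F := Matrix.of fun i j => evalAt (g : GL (Fin n) F) (p i j)
  have hN : (algebraMap F L).mapMatrix N =
      ((φ ⟨baseChange F L n g, g.2⟩ : GL (Fin m) L) : Matrix (Fin m) (Fin m) L) := by
    ext i j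
    rw [hp, evalAt_baseChange]
    rfl
  have hdet : N.det ≠ 0 := by
    intro h
    have h1 : ((algebraMap F L).mapMatrix N).det = 0 := by rw [← RingHom.map_det, h, map_zero]
    rw [hN] at h1
    exact ((Matrix.isUnit_iff_isUnit_det _).mp (Units.isUnit _)).ne_zero h1
  let u : GL (Fin m) F := Matrix.GeneralLinearGroup.mkOfDetNeZero N hdet
  have hu : baseChange F L m u = (φ ⟨baseChange F L n g, g.2⟩ : GL (Fin m) L) := Units.ext hN
  exact ⟨⟨u, by
    change baseChange F L m u ∈ T
    rw [hu]
    exact Subtype.property _⟩, hu⟩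

/-- The homomorphism induced on `F`-points by a morphism of algebraic groups defined over `F`. -/
def pointsMap {m : ℕ} {S : Subgroup (GL (Fin n) L)} {T : Subgroup (GL (Fin m) L)}
    (φ : S →* T) (hφ : IsRegularOver F φ) : points F S →* points F T where
  toFun g := (exists_points_map hφ g).choose
  map_one' := by
    apply Subtype.ext
    apply baseChange_injective (F := F) (L := L) m
    rw [(exists_points_map hφ 1).choose_spec]
    have : (⟨baseChange F L n (1 : points F S), (1 : points F S).2⟩ : S) = 1 :=
      Subtype.ext (map_one (baseChange F L n))
    rw [this]
    simp
  map_mul' a b := by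
    apply Subtype.ext
    apply baseChange_injective (F := F) (L := L) m
    have hab : (⟨baseChange F L n (a * b : points F S), (a * b).2⟩ : S) =
        ⟨baseChange F L n a, a.2⟩ * ⟨baseChange F L n b, b.2⟩ :=
      Subtype.ext (map_mul (baseChange F L n) _ _)
    have h := (exists_points_map hφ (a * b)).choose_spec.trans
      (congrArg (fun x : S => (φ x : GL (Fin m) L)) hab)
    refine h.trans ?_
    rw [map_mul, Subgroup.coe_mul, Subgroup.coe_mul, map_mul,
      (exists_points_map hφ a).choose_spec, (exists_points_map hφ b).choose_spec]

/-- The induced map on `F`-points is the restriction of the given morphism. -/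
theorem baseChange_pointsMap {m : ℕ} {S : Subgroup (GL (Fin n) L)}
    {T : Subgroup (GL (Fin m) L)} (φ : S →* T) (hφ : IsRegularOver F φ) (g : points F S) :
    baseChange F L m (pointsMap φ hφ g) = φ ⟨baseChange F L n g, g.2⟩ :=
  (exists_points_map hφ g).choose_spec

/-- The subgroup of fixed points of an endomorphism `σ` of `G`, as a subgroup of `GL_n`. -/
def fixedSubgroup {G : Subgroup (GL (Fin n) L)} (σ : G →* G) : Subgroup (GL (Fin n) L) :=
  (σ.eqLocus (MonoidHom.id G)).map G.subtype

/-- `H` is a subgroup of `K`, open in `K` for the Zariski topology. -/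
def IsOpenSubgroupOf (H K : Subgroup (GL (Fin n) L)) : Prop :=
  H ≤ K ∧ ∃ Z : Set (GL (Fin n) L), IsZariskiClosed L Z ∧
    (H : Set (GL (Fin n) L)) = (K : Set (GL (Fin n) L)) \ Z

end AlgebraicGroups

/-! ### The subgroups attached to an element of a topological group -/

section Dynamic

variable {Γ : Type*} [Group Γ] [TopologicalSpace Γ] [IsTopologicalGroup Γ]

/-- `P_l`: the `g` for which the sequence `l⁻ⁿ g lⁿ` is bounded, i.e. contained in a compact set.
For `l` in the lattice `Λ(A)` of a split torus `A` of a reductive group this is the parabolic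
subgroup whose roots `α` relative to `A` are those with `|α(l)| ≥ 1`. -/
def parabolicOf (l : Γ) : Subgroup Γ where
  carrier := {g | ∃ C : Set Γ, IsCompact C ∧ ∀ k : ℕ, (l ^ k)⁻¹ * g * l ^ k ∈ C}
  one_mem' := ⟨{1}, isCompact_singleton, fun k => by simp⟩
  mul_mem' := by
    rintro a b ⟨C, hC, ha⟩ ⟨D, hD, hb⟩
    refine ⟨C * D, hC.mul hD, fun k => ?_⟩
    have : (l ^ k)⁻¹ * (a * b) * l ^ k = ((l ^ k)⁻¹ * a * l ^ k) * ((l ^ k)⁻¹ * b * l ^ k) := by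
      group
    rw [this]
    exact Set.mul_mem_mul (ha k) (hb k)
  inv_mem' := by
    rintro a ⟨C, hC, ha⟩
    refine ⟨C⁻¹, hC.inv, fun k => ?_⟩
    have : (l ^ k)⁻¹ * a⁻¹ * l ^ k = ((l ^ k)⁻¹ * a * l ^ k)⁻¹ := by group
    rw [this]
    exact Set.inv_mem_inv.mpr (ha k)

/-- `M_l`: the centralizer of `l`, a Levi subgroup of `P_l`. -/
def leviOf (l : Γ) : Subgroup Γ where
  carrier := {g | l⁻¹ * g * l = g}
  one_mem' := by simp
  mul_mem' := by
    intro a b ha hb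
    simp only [Set.mem_ofPred_eq] at ha hb ⊢
    calc l⁻¹ * (a * b) * l = (l⁻¹ * a * l) * (l⁻¹ * b * l) := by group
      _ = a * b := by rw [ha, hb]
  inv_mem' := by
    intro a ha
    simp only [Set.mem_ofPred_eq] at ha ⊢
    calc l⁻¹ * a⁻¹ * l = (l⁻¹ * a * l)⁻¹ := by group
      _ = a⁻¹ := by rw [ha]

/-- `U_l`: the `g` for which the sequence `l⁻ⁿ g lⁿ` converges to `1`; the unipotent radical
of `P_l`. -/
def unipRadOf (l : Γ) : Subgroup Γ where
  carrier := {g | Tendsto (fun k : ℕ => (l ^ k)⁻¹ * g * l ^ k) atTop (𝓝 1)}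
  one_mem' := by
    have h : (fun k : ℕ => (l ^ k)⁻¹ * 1 * l ^ k) = fun _ => 1 := by
      funext k
      group
    simp only [Set.mem_ofPred_eq, h]
    exact tendsto_const_nhds
  mul_mem' := by
    intro a b ha hb
    simp only [Set.mem_ofPred_eq] at ha hb ⊢
    have h := ha.mul hb
    rw [one_mul] at h
    refine h.congr fun k => ?_
    group
  inv_mem' := by
    intro a ha
    simp only [Set.mem_ofPred_eq] at ha ⊢
    have h := ha.inv
    rw [inv_one] at h
    refine h.congr fun k => ?_
    group

end Dynamic

/-- `ϖ` is a uniformizer of the nonarchimedean local field `F`. -/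
def IsUniformizer {F : Type*} [Field F] [ValuativeRel F] (ϖ : Fˣ) : Prop :=
  ∃ π : (ValuativeRel.valuation F).integer, Irreducible π ∧ (π : F) = ϖ

end RedSym

end

/-!
The argument is elementary and takes place in coordinates. A one-parameter subgroup `c` defined
over `F` is a Laurent polynomial in its parameter `t ∈ Fˣ`, and its coefficients are projections
onto weight spaces (`exists_weight_decomposition`). The values of `c` commute with those of `σ ∘ c`,
because `A` is commutative and `σ`-stable; so one basis diagonalizes `l`, `σ l` and
`μ = l * σ l`, with entries that are powers of the uniformizer (`exists_isDiagonalizedBy`). In such a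
basis, conjugation by `l ^ k` scales matrix entries by powers of the uniformizer, and `P_l`, `M_l`,
`U_l` are described by the vanishing of entries (`mem_parabolicOf_iff`, `mem_leviOf_iff`,
`mem_unipRadOf_iff`). This gives the identities between intersections of these groups for `l`, `σ l`
and `μ`, and shows that for `g ∈ P_l` the sequence `l⁻ᵏ g lᵏ` converges, to an element of every
group `P` or `U` attached to these three elements that contains `g`.

If, for all `g` in a subgroup `K`, the sequence `l⁻ᵏ g lᵏ` has a limit in `K`, then `K` is the
semidirect product of `M_l ∩ K` and its normal subgroup `U_l ∩ K` (`levi_decomposition`). The three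
decompositions in (i) and (ii), and the one in (iii), are this statement for the groups
`P ∩ σ(P)`, `V'`, `U ∩ σ(P)` and `P ∩ H`, with `μ`, `l`, `σ l` and `μ` respectively. For `P ∩ H` one
needs `μ ∈ H`: the curve `t ↦ c t * σ (c t)` consists of fixed points and starts at `1`, and a curve
cannot leave a subgroup that is both Zariski open and closed
(`IsLaurentCurve.mem_of_isOpenSubgroupOf`).

For (iv), `x * σ x` is fixed by `σ` up to the commutator `w` of `x` and `σ x`, which lies in
`U ∩ σ(U)` and satisfies `σ w = w⁻¹`. Elements of `U` are unipotent, so in characteristic zero the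
binomial series gives their powers with arbitrary exponents in `F`; as polynomial identities that
hold for natural exponents hold for all of them, the square root of `w` is again in `U ∩ σ(U)` and is
inverted by `σ`, and multiplying `x * σ x` by it gives a fixed element `h` (`exists_fixed_mul`). The
powers of `h` form a curve of fixed points through `1` and `h`, whence `h ∈ H`.
-/

namespace RedSym

/-! ### Powers of a uniformizer -/

section LocalField

variable {F : Type*} [Field F] [ValuativeRel F]

theorem IsUniformizer.valuation_lt_one {ϖ : Fˣ} (hϖ : IsUniformizer ϖ) :
    ValuativeRel.valuation F (ϖ : F) < 1 := by
  obtain ⟨π, hπ, hπϖ⟩ := hϖ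
  rw [← hπϖ]
  refine lt_of_le_of_ne π.2 fun h => hπ.not_isUnit ?_
  exact (Valuation.integer.integers (ValuativeRel.valuation F)).isUnit_iff_valuation_eq_one.mpr h

variable [TopologicalSpace F] [IsNonarchimedeanLocalField F]

variable (F) in
theorem t2Space_of_isNonarchimedeanLocalField : T2Space F := by
  let := IsTopologicalAddGroup.rightUniformSpace F
  have := isUniformAddGroup_of_addCommGroup (G := F)
  infer_instance

theorem IsUniformizer.tendsto_pow {ϖ : Fˣ} (hϖ : IsUniformizer ϖ) :
    Tendsto (fun k : ℕ => (ϖ : F) ^ k) atTop (𝓝 0) := by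
  rw [(IsValuativeTopology.hasBasis_nhds_zero' F).tendsto_right_iff]
  intro γ hγ
  have : MulArchimedean (ValuativeRel.ValueGroupWithZero F) :=
    ValuativeRel.isRankLeOne_iff_mulArchimedean.mp inferInstance
  obtain ⟨k, hk⟩ := exists_pow_lt₀ hϖ.valuation_lt_one (Units.mk0 γ hγ)
  filter_upwards [eventually_ge_atTop k] with m hm
  rw [map_pow]
  exact (pow_le_pow_right_of_le_one' hϖ.valuation_lt_one.le hm).trans_lt hk

end LocalField

/-! ### Contraction by a semisimple element of `GL_n` -/

section Contraction

variable {F : Type*} [Field F] {n : ℕ} {ϖ : Fˣ}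

/-- The matrix of `g` in the basis given by `Q`. -/
def conjMatrix (Q g : GL (Fin n) F) : Matrix (Fin n) (Fin n) F := ((Q * g * Q⁻¹ : GL (Fin n) F))

/-- In the basis given by `Q`, the element `l` is diagonal with entries `ϖ ^ w i`. -/
def IsDiagonalizedBy (ϖ : Fˣ) (Q : GL (Fin n) F) (w : Fin n → ℤ) (l : GL (Fin n) F) : Prop :=
  conjMatrix Q l = Matrix.diagonal fun i => ((ϖ ^ w i : Fˣ) : F)

@[simp] theorem conjMatrix_one (Q : GL (Fin n) F) : conjMatrix Q 1 = 1 := by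
  simp [conjMatrix]

theorem conjMatrix_mul (Q g h : GL (Fin n) F) :
    conjMatrix Q (g * h) = conjMatrix Q g * conjMatrix Q h := by
  simp only [conjMatrix, ← Units.val_mul]
  congr 1
  group

theorem coe_eq_conjMatrix (Q g : GL (Fin n) F) :
    (g : Matrix (Fin n) (Fin n) F) =
      (Q⁻¹ : GL (Fin n) F) * conjMatrix Q g * (Q : Matrix (Fin n) (Fin n) F) := by
  simp only [conjMatrix, ← Units.val_mul]
  congr 1
  group

theorem conjMatrix_injective (Q : GL (Fin n) F) : Function.Injective (conjMatrix Q) := by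
  intro a b h
  apply Units.ext
  rw [coe_eq_conjMatrix Q a, h, ← coe_eq_conjMatrix]

namespace IsDiagonalizedBy

variable {Q l l' : GL (Fin n) F} {w w' : Fin n → ℤ}

theorem one : IsDiagonalizedBy ϖ Q 0 1 := by
  simp [IsDiagonalizedBy]

theorem mul (h : IsDiagonalizedBy ϖ Q w l) (h' : IsDiagonalizedBy ϖ Q w' l') :
    IsDiagonalizedBy ϖ Q (w + w') (l * l') := by
  unfold IsDiagonalizedBy at *
  rw [conjMatrix_mul, h, h', Matrix.diagonal_mul_diagonal]
  congr 1
  ext i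
  rw [Pi.add_apply, _root_.zpow_add, Units.val_mul]

theorem inv (h : IsDiagonalizedBy ϖ Q w l) : IsDiagonalizedBy ϖ Q (-w) l⁻¹ := by
  unfold IsDiagonalizedBy at *
  have h1 : conjMatrix Q l * conjMatrix Q l⁻¹ = 1 := by
    rw [← conjMatrix_mul, mul_inv_cancel, conjMatrix_one]
  have h2 : Matrix.diagonal (fun i => ((ϖ ^ (-w) i : Fˣ) : F)) * conjMatrix Q l = 1 := by
    rw [h, Matrix.diagonal_mul_diagonal, ← Matrix.diagonal_one]
    congr 1
    ext i
    rw [← Units.val_mul, ← _root_.zpow_add]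
    simp
  exact (left_inv_eq_right_inv h2 h1).symm

theorem pow (h : IsDiagonalizedBy ϖ Q w l) (k : ℕ) :
    IsDiagonalizedBy ϖ Q (fun i => k * w i) (l ^ k) := by
  induction k with
  | zero => simpa using! one (ϖ := ϖ) (Q := Q)
  | succ k ih =>
    rw [pow_succ]
    convert ih.mul h using 1
    ext i
    simp
    ring

/-- Conjugation by `l ^ k` scales the entries of a matrix in a basis diagonalizing `l`. -/
theorem conjMatrix_conj_apply (h : IsDiagonalizedBy ϖ Q w l) (g : GL (Fin n) F) (k : ℕ)
    (i j : Fin n) :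
    conjMatrix Q ((l ^ k)⁻¹ * g * l ^ k) i j =
      ((ϖ ^ (k * (w j - w i)) : Fˣ) : F) * conjMatrix Q g i j := by
  have h1 := h.pow k
  have h2 := h1.inv
  unfold IsDiagonalizedBy at h1 h2
  rw [conjMatrix_mul, conjMatrix_mul, h1, h2, Matrix.mul_diagonal, Matrix.diagonal_mul]
  rw [mul_right_comm, ← Units.val_mul, ← _root_.zpow_add]
  congr 3
  simp only [Pi.neg_apply]
  ring

theorem conjMatrix_inv_conj_apply (h : IsDiagonalizedBy ϖ Q w l) (g : GL (Fin n) F) (k : ℕ) (i j : Fin n) :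
    conjMatrix Q ((l ^ k)⁻¹ * g * l ^ k)⁻¹ i j =
      ((ϖ ^ (k * (w j - w i)) : Fˣ) : F) * conjMatrix Q g⁻¹ i j := by
  rw [← h.conjMatrix_conj_apply g⁻¹]
  congr 2
  group

end IsDiagonalizedBy

variable [TopologicalSpace F] [IsTopologicalRing F]

/-- A null sequence times a bounded sequence is null, so the product can only be constant if it is
zero. -/
theorem eq_zero_of_forall_mul_mem_isCompact [T2Space F] {c y : ℕ → F} {x : F} {K : Set F}
    (hK : IsCompact K) (hc : Tendsto c atTop (𝓝 0)) (hy : ∀ k, y k ∈ K)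
    (h : ∀ k, c k * y k = x) : x = 0 := by
  -- along an ultrafilter `y` converges, whence `c * y` tends to zero
  obtain ⟨a, -, ha⟩ := hK (f := (Ultrafilter.of (map y atTop) : Filter F))
    ((Ultrafilter.of_le _).trans (le_principal_iff.mpr (Filter.mem_map.mpr (by simp [hy]))))
  have hcl : MapClusterPt a atTop y := by
    refine ClusterPt.mono ha (Ultrafilter.of_le _)
  obtain ⟨U, hU, hUa⟩ := mapClusterPt_iff_ultrafilter.mp hcl
  have h1 : Tendsto (fun k => c k * y k) U (𝓝 (0 * a)) := (hc.mono_left hU).mul hUa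
  simp only [h, zero_mul] at h1
  exact tendsto_nhds_unique tendsto_const_nhds h1

theorem continuous_conjMatrix (Q : GL (Fin n) F) : Continuous (conjMatrix Q) :=
  (continuous_const.matrix_mul Units.continuous_val).matrix_mul continuous_const

/-- Convergence in `GL_n` is convergence of the entries of the matrix and of its inverse, in any
basis. -/
theorem tendsto_GL_iff {x : ℕ → GL (Fin n) F} {m : GL (Fin n) F} (Q : GL (Fin n) F) :
    Tendsto x atTop (𝓝 m) ↔
      ∀ i j, Tendsto (fun k => conjMatrix Q (x k) i j) atTop (𝓝 (conjMatrix Q m i j)) ∧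
        Tendsto (fun k => conjMatrix Q (x k)⁻¹ i j) atTop (𝓝 (conjMatrix Q m⁻¹ i j)) := by
  constructor
  · intro h i j
    have hc : ∀ f : GL (Fin n) F → GL (Fin n) F, Continuous f →
        Tendsto (fun k => conjMatrix Q (f (x k)) i j) atTop (𝓝 (conjMatrix Q (f m) i j)) :=
      fun f hf => ((((continuous_conjMatrix Q).comp hf).matrix_elem i j).tendsto m).comp h
    exact ⟨hc id continuous_id, hc _ continuous_inv⟩
  · intro h
    have hc : ∀ (y : ℕ → GL (Fin n) F) (b : GL (Fin n) F),
        (∀ i j, Tendsto (fun k => conjMatrix Q (y k) i j) atTop (𝓝 (conjMatrix Q b i j))) →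
        Tendsto (fun k => (y k : Matrix (Fin n) (Fin n) F)) atTop (𝓝 (b : Matrix _ _ F)) := by
      intro y b hy
      have h1 : Tendsto (fun k => conjMatrix Q (y k)) atTop (𝓝 (conjMatrix Q b)) :=
        tendsto_pi_nhds.mpr fun i => tendsto_pi_nhds.mpr fun j => hy i j
      rw [coe_eq_conjMatrix Q b]
      refine Tendsto.congr (fun k => (coe_eq_conjMatrix Q (y k)).symm) ?_
      exact (tendsto_const_nhds.mul h1).mul tendsto_const_nhds
    rw [Units.isEmbedding_embedProduct.tendsto_nhds_iff, Prod.tendsto_iff,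
      MulOpposite.opHomeomorph.symm.isEmbedding.tendsto_nhds_iff]
    exact ⟨hc x m fun i j => (h i j).1, hc (fun k => (x k)⁻¹) m⁻¹ fun i j => (h i j).2⟩

end Contraction

/-! ### The parabolic subgroup, its Levi subgroup and its radical in coordinates -/

section Coordinates

variable {F : Type*} [Field F] [TopologicalSpace F] {n : ℕ}
  {ϖ : Fˣ} {G : Subgroup (GL (Fin n) F)}
  {Q : GL (Fin n) F} {w w' : Fin n → ℤ} {l l' : G}

theorem tendsto_zpow_mul (hϖ : Tendsto (fun k : ℕ => (ϖ : F) ^ k) atTop (𝓝 0)) {a : ℤ}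
    (ha : 0 < a) : Tendsto (fun k : ℕ => ((ϖ ^ (k * a) : Fˣ) : F)) atTop (𝓝 0) := by
  lift a to ℕ using ha.le
  have h : Tendsto (fun k : ℕ => k * a) atTop atTop :=
    tendsto_id.atTop_mul_const' (by exact_mod_cast ha)
  refine (hϖ.comp h).congr fun k => ?_
  simp only [Function.comp]
  rw [← Units.val_pow_eq_pow_val]
  congr 1

variable [T2Space F]

theorem mem_leviOf_iff (hϖ : Tendsto (fun k : ℕ => (ϖ : F) ^ k) atTop (𝓝 0))
    (hl : IsDiagonalizedBy ϖ Q w (l : GL (Fin n) F)) {g : G} :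
    g ∈ leviOf l ↔ ∀ i j, w i ≠ w j → conjMatrix Q (g : GL (Fin n) F) i j = 0 := by
  -- the uniformizer is not a root of unity
  have hpow : ∀ a : ℤ, 0 < a → ((ϖ ^ a : Fˣ) : F) ≠ 1 := by
    intro a ha h
    refine zero_ne_one (tendsto_nhds_unique (tendsto_zpow_mul hϖ ha) ?_)
    have h1 : ϖ ^ a = 1 := Units.ext h
    simp [mul_comm _ a, _root_.zpow_mul, h1]
  have hpow' : ∀ a : ℤ, a ≠ 0 → ((ϖ ^ a : Fˣ) : F) ≠ 1 := by
    intro a ha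
    rcases ha.lt_or_gt with h | h
    · intro h1
      have h2 : ϖ ^ a = 1 := Units.ext h1
      refine hpow (-a) (by omega) ?_
      rw [_root_.zpow_neg, h2, inv_one, Units.val_one]
    · exact hpow a h
  have key : g ∈ leviOf l ↔ ∀ i j, ((ϖ ^ (w j - w i) : Fˣ) : F) *
      conjMatrix Q (g : GL (Fin n) F) i j = conjMatrix Q (g : GL (Fin n) F) i j := by
    change l⁻¹ * g * l = g ↔ _
    rw [← Subtype.coe_inj, ← (conjMatrix_injective Q).eq_iff, ← Matrix.ext_iff]
    refine forall₂_congr fun i j => ?_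
    have := hl.conjMatrix_conj_apply g 1 i j
    simp only [pow_one, Nat.cast_one, one_mul] at this
    simp only [Subgroup.coe_mul, Subgroup.coe_inv, this]
  rw [key]
  refine forall₂_congr fun i j => ?_
  by_cases hij : w i = w j
  · simp [hij]
  · have h1 := hpow' (w j - w i) (by omega)
    simp only [ne_eq, hij, not_false_eq_true, forall_const]
    rw [mul_left_eq_self₀, or_iff_right h1]

variable [IsTopologicalRing F]

/-- A nonzero entry in a position with `w j < w i` would be unbounded under conjugation by the powers
of `l`. -/
theorem conjMatrix_eq_zero_of_mem_parabolicOf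
    (hϖ : Tendsto (fun k : ℕ => (ϖ : F) ^ k) atTop (𝓝 0))
    (hl : IsDiagonalizedBy ϖ Q w (l : GL (Fin n) F)) {g : G} (hg : g ∈ parabolicOf l)
    {i j : Fin n} (hij : w j < w i) : conjMatrix Q (g : GL (Fin n) F) i j = 0 := by
  obtain ⟨C, hC, hgC⟩ := hg
  have hcont : Continuous fun x : G => conjMatrix Q (x : GL (Fin n) F) i j :=
    ((continuous_conjMatrix Q).comp continuous_subtype_val).matrix_elem i j
  refine eq_zero_of_forall_mul_mem_isCompact (hC.image hcont)
    (tendsto_zpow_mul hϖ (sub_pos.mpr hij)) (fun k => Set.mem_image_of_mem _ (hgC k)) fun k => ?_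
  simp only [Subgroup.coe_mul, Subgroup.coe_inv, Subgroup.coe_pow]
  rw [hl.conjMatrix_conj_apply, ← mul_assoc, ← Units.val_mul, ← _root_.zpow_add]
  have : (k : ℤ) * (w i - w j) + k * (w j - w i) = 0 := by ring
  simp [this]

/-- If the matrices of `g` and `g⁻¹` are block triangular with respect to the weights `w` of `l`,
then `l⁻ᵏ g lᵏ` converges to the block diagonal part of `g`. -/
theorem exists_tendsto_conj (hϖ : Tendsto (fun k : ℕ => (ϖ : F) ^ k) atTop (𝓝 0))
    (hG : IsClosed (G : Set (GL (Fin n) F)))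
    (hl : IsDiagonalizedBy ϖ Q w (l : GL (Fin n) F)) {g : G}
    (hg : ∀ i j, w j < w i → conjMatrix Q (g : GL (Fin n) F) i j = 0 ∧
      conjMatrix Q (g : GL (Fin n) F)⁻¹ i j = 0) :
    ∃ m : G, Tendsto (fun k : ℕ => (l ^ k)⁻¹ * g * l ^ k) atTop (𝓝 m) ∧
      ∀ i j, conjMatrix Q (m : GL (Fin n) F) i j =
          (if w i = w j then conjMatrix Q (g : GL (Fin n) F) i j else 0) ∧
        conjMatrix Q (m : GL (Fin n) F)⁻¹ i j =
          (if w i = w j then conjMatrix Q (g : GL (Fin n) F)⁻¹ i j else 0) := by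
  -- `B g` is the block diagonal part of `g`; `B g * B g⁻¹ = 1` by passing to the limit
  let x : ℕ → GL (Fin n) F := fun k => ((l : GL (Fin n) F) ^ k)⁻¹ * g * l ^ k
  let B : GL (Fin n) F → Matrix (Fin n) (Fin n) F :=
    fun g => Matrix.of fun i j => if w i = w j then conjMatrix Q g i j else 0
  have key : ∀ (c : F) (i j : Fin n), (w j < w i → c = 0) →
      Tendsto (fun k : ℕ => ((ϖ ^ (k * (w j - w i)) : Fˣ) : F) * c) atTop
        (𝓝 (if w i = w j then c else 0)) := by
    intro c i j hc
    rcases lt_trichotomy (w i) (w j) with h | h | h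
    · rw [if_neg h.ne]
      simpa using (tendsto_zpow_mul hϖ (sub_pos.mpr h)).mul_const c
    · simp [h]
    · simp [hc h]
  have h1 : ∀ i j, Tendsto (fun k => conjMatrix Q (x k) i j) atTop
      (𝓝 (B g i j)) := fun i j =>
    (key _ i j fun h => (hg i j h).1).congr fun k => (hl.conjMatrix_conj_apply _ k i j).symm
  have h2 : ∀ i j, Tendsto (fun k => conjMatrix Q (x k)⁻¹ i j) atTop
      (𝓝 (B (g : GL (Fin n) F)⁻¹ i j)) := fun i j =>
    (key _ i j fun h => (hg i j h).2).congr fun k => (hl.conjMatrix_inv_conj_apply _ k i j).symm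
  have h1' : Tendsto (fun k => conjMatrix Q (x k)) atTop (𝓝 (B g)) :=
    tendsto_pi_nhds.mpr fun i => tendsto_pi_nhds.mpr fun j => h1 i j
  have h2' : Tendsto (fun k => conjMatrix Q (x k)⁻¹) atTop (𝓝 (B (g : GL (Fin n) F)⁻¹)) :=
    tendsto_pi_nhds.mpr fun i => tendsto_pi_nhds.mpr fun j => h2 i j
  have e1 : B g * B (g : GL (Fin n) F)⁻¹ = 1 := by
    refine tendsto_nhds_unique (h1'.mul h2') ?_
    simp [← conjMatrix_mul]
  have e2 : B (g : GL (Fin n) F)⁻¹ * B g = 1 := by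
    refine tendsto_nhds_unique (h2'.mul h1') ?_
    simp [← conjMatrix_mul]
  let D : GL (Fin n) F := ⟨B g, B (g : GL (Fin n) F)⁻¹, e1, e2⟩
  have hD : conjMatrix Q (Q⁻¹ * D * Q) = B g := by
    have : Q * (Q⁻¹ * D * Q) * Q⁻¹ = D := by group
    rw [conjMatrix, this]
  have hD' : conjMatrix Q (Q⁻¹ * D * Q)⁻¹ = B (g : GL (Fin n) F)⁻¹ := by
    have : Q * (Q⁻¹ * D * Q)⁻¹ * Q⁻¹ = D⁻¹ := by group
    rw [conjMatrix, this]
    rfl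
  have hx : Tendsto x atTop (𝓝 (Q⁻¹ * D * Q)) := by
    rw [tendsto_GL_iff Q, hD, hD']
    exact fun i j => ⟨h1 i j, h2 i j⟩
  have hm : Q⁻¹ * D * Q ∈ G := by
    refine hG.mem_of_tendsto hx (Eventually.of_forall fun k => ?_)
    exact ((l ^ k)⁻¹ * g * l ^ k : G).2
  refine ⟨⟨_, hm⟩, tendsto_subtype_rng.mpr hx, fun i j => ?_⟩
  simp only [hD, hD']
  exact ⟨rfl, rfl⟩

theorem mem_parabolicOf_iff (hϖ : Tendsto (fun k : ℕ => (ϖ : F) ^ k) atTop (𝓝 0))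
    (hG : IsClosed (G : Set (GL (Fin n) F)))
    (hl : IsDiagonalizedBy ϖ Q w (l : GL (Fin n) F)) {g : G} :
    g ∈ parabolicOf l ↔ ∀ i j, w j < w i → conjMatrix Q (g : GL (Fin n) F) i j = 0 ∧
      conjMatrix Q (g : GL (Fin n) F)⁻¹ i j = 0 := by
  constructor
  · intro hg i j hij
    exact ⟨conjMatrix_eq_zero_of_mem_parabolicOf hϖ hl hg hij,
      conjMatrix_eq_zero_of_mem_parabolicOf hϖ hl (inv_mem hg) hij⟩
  · intro hg
    obtain ⟨m, hm, -⟩ := exists_tendsto_conj hϖ hG hl hg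
    exact ⟨_, hm.isCompact_insert_range, fun k => Set.mem_insert_of_mem _ ⟨k, rfl⟩⟩

theorem mem_unipRadOf_iff (hϖ : Tendsto (fun k : ℕ => (ϖ : F) ^ k) atTop (𝓝 0))
    (hG : IsClosed (G : Set (GL (Fin n) F)))
    (hl : IsDiagonalizedBy ϖ Q w (l : GL (Fin n) F)) {g : G} :
    g ∈ unipRadOf l ↔ (∀ i j, w j < w i → conjMatrix Q (g : GL (Fin n) F) i j = 0 ∧
      conjMatrix Q (g : GL (Fin n) F)⁻¹ i j = 0) ∧
      ∀ i j, w i = w j → conjMatrix Q (g : GL (Fin n) F) i j =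
        (1 : Matrix (Fin n) (Fin n) F) i j := by
  constructor
  · intro hg
    have hP : g ∈ parabolicOf l :=
      ⟨_, Tendsto.isCompact_insert_range hg, fun k => Set.mem_insert_of_mem _ ⟨k, rfl⟩⟩
    have hP' := (mem_parabolicOf_iff hϖ hG hl).mp hP
    refine ⟨hP', fun i j hij => ?_⟩
    obtain ⟨m, hm, hm'⟩ := exists_tendsto_conj hϖ hG hl hP'
    obtain rfl : m = 1 := tendsto_nhds_unique hm hg
    simpa [hij] using (hm' i j).1.symm
  · rintro ⟨hP, h1⟩
    obtain ⟨m, hm, hm'⟩ := exists_tendsto_conj hϖ hG hl hP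
    obtain rfl : m = 1 := by
      apply Subtype.ext
      apply conjMatrix_injective Q
      ext i j
      rw [(hm' i j).1]
      by_cases hij : w i = w j
      · simp [hij, h1 i j hij]
      · have : i ≠ j := fun h => hij (by rw [h])
        simp [hij, this]
    exact hm

end Coordinates

/-! ### Levi decompositions -/

section LeviDecomposition

variable {Γ : Type*} [Group Γ]

theorem conj_pow_eq_of_mem_leviOf {l m : Γ} (hm : m ∈ leviOf l) (k : ℕ) :
    (l ^ k)⁻¹ * m * l ^ k = m := by
  have h : Commute m l := by
    change l⁻¹ * m * l = m at hm
    rw [mul_assoc, inv_mul_eq_iff_eq_mul] at hm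
    exact hm
  rw [mul_assoc, (h.pow_right k).eq, inv_mul_cancel_left]

variable [TopologicalSpace Γ] [IsTopologicalGroup Γ]

theorem leviOf_le_parabolicOf (l : Γ) : leviOf l ≤ parabolicOf l := fun g hg =>
  ⟨{g}, isCompact_singleton, fun k => conj_pow_eq_of_mem_leviOf hg k⟩

theorem unipRadOf_le_parabolicOf (l : Γ) : unipRadOf l ≤ parabolicOf l := fun _ hg =>
  ⟨_, Tendsto.isCompact_insert_range hg, fun k => Set.mem_insert_of_mem _ ⟨k, rfl⟩⟩

variable [T2Space Γ]

theorem mem_leviOf_of_tendsto {l g m : Γ}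
    (h : Tendsto (fun k : ℕ => (l ^ k)⁻¹ * g * l ^ k) atTop (𝓝 m)) : m ∈ leviOf l := by
  have h1 := (tendsto_const_nhds (x := l⁻¹)).mul (h.mul (tendsto_const_nhds (x := l)))
  have h2 := h.comp (tendsto_add_atTop_nat 1)
  change l⁻¹ * m * l = m
  rw [mul_assoc]
  refine tendsto_nhds_unique h1 (h2.congr fun k => ?_)
  simp only [Function.comp, pow_succ]
  group

theorem leviOf_inf_unipRadOf (l : Γ) : leviOf l ⊓ unipRadOf l = ⊥ := by
  refine (Subgroup.eq_bot_iff_forall _).mpr fun g hg => ?_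
  have h := hg.2
  change Tendsto _ _ _ at h
  simp only [conj_pow_eq_of_mem_leviOf hg.1] at h
  exact tendsto_nhds_unique tendsto_const_nhds h

/-- If `l⁻ᵏ g lᵏ` has a limit in `K` for every `g` in the subgroup `K`, then sending `g` to this
limit is a retraction of `K` onto `M_l ∩ K` with kernel `U_l ∩ K`. -/
theorem levi_decomposition {l : Γ} {K : Subgroup Γ}
    (hK : ∀ g ∈ K, ∃ m ∈ K, Tendsto (fun k : ℕ => (l ^ k)⁻¹ * g * l ^ k) atTop (𝓝 m)) :
    (K : Set Γ) = ((leviOf l ⊓ K : Subgroup Γ) : Set Γ) * ((unipRadOf l ⊓ K : Subgroup Γ) : Set Γ) ∧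
      IsNormalIn (unipRadOf l ⊓ K) K := by
  refine ⟨Set.Subset.antisymm ?_ ?_, inf_le_right, ?_⟩
  · intro g hg
    obtain ⟨m, hmK, hm⟩ := hK g hg
    have hml := mem_leviOf_of_tendsto hm
    refine Set.mem_mul.mpr ⟨m, ⟨hml, hmK⟩, m⁻¹ * g, ⟨?_, K.mul_mem (K.inv_mem hmK) hg⟩,
      mul_inv_cancel_left m g⟩
    have h1 := (tendsto_const_nhds (x := m⁻¹)).mul hm
    rw [inv_mul_cancel] at h1
    refine h1.congr fun k => ?_
    nth_rw 1 [← conj_pow_eq_of_mem_leviOf ((leviOf l).inv_mem hml) k]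
    group
  · rintro _ ⟨a, ha, b, hb, rfl⟩
    exact mul_mem ha.2 hb.2
  · refine ⟨fun v hv g => ?_⟩
    rw [Subgroup.mem_subgroupOf] at hv ⊢
    obtain ⟨m, hmK, hm⟩ := hK g g.2
    refine ⟨?_, (g * v * g⁻¹).2⟩
    have h1 := (hm.mul hv.1).mul hm.inv
    rw [mul_one, mul_inv_cancel] at h1
    refine h1.congr fun k => ?_
    push_cast
    group

end LeviDecomposition

section Limits

variable {F : Type*} [Field F] [TopologicalSpace F] [IsTopologicalRing F] [T2Space F] {n : ℕ}
  {ϖ : Fˣ} {G : Subgroup (GL (Fin n) F)}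
  {Q : GL (Fin n) F} {w w' : Fin n → ℤ} {l l' : G}

/-- The limit `m` of `l⁻ᵏ g lᵏ`, for `g ∈ P_l`, lies in every `P_l'` and every `U_l'` that contains
`g`, where `l'` is diagonalized by the same basis as `l`. -/
theorem exists_tendsto_of_mem_parabolicOf
    (hϖ : Tendsto (fun k : ℕ => (ϖ : F) ^ k) atTop (𝓝 0))
    (hG : IsClosed (G : Set (GL (Fin n) F)))
    (hl : IsDiagonalizedBy ϖ Q w (l : GL (Fin n) F)) {g : G} (hg : g ∈ parabolicOf l) :
    ∃ m : G, Tendsto (fun k : ℕ => (l ^ k)⁻¹ * g * l ^ k) atTop (𝓝 m) ∧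
      ∀ (l' : G) (w' : Fin n → ℤ), IsDiagonalizedBy ϖ Q w' (l' : GL (Fin n) F) →
        (g ∈ parabolicOf l' → m ∈ parabolicOf l') ∧ (g ∈ unipRadOf l' → m ∈ unipRadOf l') := by
  obtain ⟨m, hm, hm'⟩ := exists_tendsto_conj hϖ hG hl ((mem_parabolicOf_iff hϖ hG hl).mp hg)
  refine ⟨m, hm, fun l' w' hl' => ?_⟩
  rw [mem_parabolicOf_iff hϖ hG hl', mem_parabolicOf_iff hϖ hG hl', mem_unipRadOf_iff hϖ hG hl',
    mem_unipRadOf_iff hϖ hG hl']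
  have hP : (∀ i j, w' j < w' i → conjMatrix Q (g : GL (Fin n) F) i j = 0 ∧
      conjMatrix Q (g : GL (Fin n) F)⁻¹ i j = 0) →
      ∀ i j, w' j < w' i → conjMatrix Q (m : GL (Fin n) F) i j = 0 ∧
      conjMatrix Q (m : GL (Fin n) F)⁻¹ i j = 0 := by
    intro h i j hij
    simp [hm' i j, h i j hij]
  refine ⟨hP, fun h => ⟨hP h.1, fun i j hij => ?_⟩⟩
  rw [(hm' i j).1, h.2 i j hij]
  split_ifs with h1
  · rfl
  · rw [Matrix.one_apply_ne fun h => h1 (by rw [h])]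

variable (hϖ : Tendsto (fun k : ℕ => (ϖ : F) ^ k) atTop (𝓝 0))
  (hG : IsClosed (G : Set (GL (Fin n) F)))
  (hl : IsDiagonalizedBy ϖ Q w (l : GL (Fin n) F))
  (hl' : IsDiagonalizedBy ϖ Q w' (l' : GL (Fin n) F))

include hϖ hG hl hl'

theorem parabolicOf_inf_le : parabolicOf l ⊓ parabolicOf l' ≤ parabolicOf (l * l') := by
  intro g hg
  rw [Subgroup.mem_inf, mem_parabolicOf_iff hϖ hG hl, mem_parabolicOf_iff hϖ hG hl'] at hg
  rw [mem_parabolicOf_iff hϖ hG (l := l * l') (hl.mul hl')]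
  intro i j hij
  simp only [Pi.add_apply] at hij
  by_cases h : w j < w i
  · exact hg.1 i j h
  · exact hg.2 i j (by omega)

/-- In `P_l ∩ P_l'` the roots are nonnegative on both `l` and `l'`, so a root that vanishes on the
product vanishes on both. -/
theorem leviOf_mul_inf_parabolicOf :
    leviOf (l * l') ⊓ (parabolicOf l ⊓ parabolicOf l') = leviOf l ⊓ leviOf l' := by
  apply le_antisymm
  · intro g hg
    simp only [Subgroup.mem_inf, mem_parabolicOf_iff hϖ hG hl, mem_parabolicOf_iff hϖ hG hl',
      mem_leviOf_iff hϖ (l := l * l') (hl.mul hl'), mem_leviOf_iff hϖ hl,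
      mem_leviOf_iff hϖ hl', Pi.add_apply] at hg ⊢
    obtain ⟨h1, h2, h3⟩ := hg
    have : ∀ i j, ¬ (w i = w j ∧ w' i = w' j) → conjMatrix Q (g : GL (Fin n) F) i j = 0 := by
      intro i j hij
      by_cases h4 : w j < w i
      · exact (h2 i j h4).1
      by_cases h5 : w' j < w' i
      · exact (h3 i j h5).1
      exact h1 i j (by omega)
    exact ⟨fun i j h => this i j fun h' => h h'.1, fun i j h => this i j fun h' => h h'.2⟩
  · refine le_inf (fun g hg => ?_) (inf_le_inf (leviOf_le_parabolicOf l) (leviOf_le_parabolicOf l'))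
    have h1 := hg.1
    have h2 := hg.2
    change l⁻¹ * g * l = g at h1
    change l'⁻¹ * g * l' = g at h2
    change (l * l')⁻¹ * g * (l * l') = g
    calc (l * l')⁻¹ * g * (l * l') = l'⁻¹ * (l⁻¹ * g * l) * l' := by group
      _ = g := by rw [h1, h2]

theorem leviOf_inf_unipRadOf_mul :
    leviOf l ⊓ ((parabolicOf l ⊓ parabolicOf l') ⊓ unipRadOf (l * l')) =
      leviOf l ⊓ unipRadOf l' := by
  ext g
  simp only [Subgroup.mem_inf]
  refine and_congr_right fun hM => ?_
  have hP := leviOf_le_parabolicOf l hM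
  have hM' := (mem_leviOf_iff hϖ hl).mp hM
  have hM'' := (mem_leviOf_iff hϖ hl).mp (inv_mem hM)
  simp only [hP, true_and, mem_parabolicOf_iff hϖ hG hl', mem_unipRadOf_iff hϖ hG hl',
    mem_unipRadOf_iff hϖ hG (l := l * l') (hl.mul hl'), Pi.add_apply]
  have h1 : ∀ i j, w i ≠ w j → conjMatrix Q (g : GL (Fin n) F) i j =
      (1 : Matrix (Fin n) (Fin n) F) i j := by
    intro i j h
    rw [hM' i j h, Matrix.one_apply_ne fun h' => h (by rw [h'])]
  constructor
  · rintro ⟨h2, h3, h4⟩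
    refine ⟨h2, fun i j hij => ?_⟩
    by_cases h5 : w i = w j
    · exact h4 i j (by omega)
    · exact h1 i j h5
  · rintro ⟨h2, h3⟩
    refine ⟨h2, fun i j hij => ?_, fun i j hij => ?_⟩
    · by_cases h5 : w i = w j
      · exact h2 i j (by omega)
      · exact ⟨hM' i j h5, hM'' i j h5⟩
    · by_cases h5 : w i = w j
      · exact h3 i j (by omega)
      · exact h1 i j h5

theorem unipRadOf_inf_unipRadOf_mul :
    unipRadOf l ⊓ ((parabolicOf l ⊓ parabolicOf l') ⊓ unipRadOf (l * l')) =
      unipRadOf l ⊓ parabolicOf l' := by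
  apply le_antisymm
  · exact inf_le_inf_left _ (inf_le_left.trans inf_le_right)
  refine fun g hg => ⟨hg.1, ⟨unipRadOf_le_parabolicOf l hg.1, hg.2⟩, ?_⟩
  have hU := (mem_unipRadOf_iff hϖ hG hl).mp hg.1
  have hP := (mem_parabolicOf_iff hϖ hG hl').mp hg.2
  refine (mem_unipRadOf_iff hϖ hG (l := l * l') (hl.mul hl')).mpr
    ⟨fun i j hij => ?_, fun i j hij => ?_⟩ <;> simp only [Pi.add_apply] at hij
  · by_cases h : w j < w i
    · exact hU.1 i j h
    · exact hP i j (by omega)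
  · by_cases h : w i = w j
    · exact hU.2 i j h
    · have : i ≠ j := fun h' => h (by rw [h'])
      rw [Matrix.one_apply_ne this]
      by_cases h : w j < w i
      · exact (hU.1 i j h).1
      · exact (hP i j (by omega)).1

end Limits

/-! ### Laurent polynomial curves in `GL_n` -/

section LaurentFunctions

variable (F K : Type*) [Field F] [Field K] [Algebra F K]

/-- The functions on `Fˣ` that are given by a Laurent polynomial with coefficients in `K`. -/
def laurentFunctions : Subalgebra K (Fˣ → K) where
  carrier := {f | ∃ (N : ℕ) (P : Polynomial K),
    ∀ t : Fˣ, algebraMap F K t ^ N * f t = P.eval (algebraMap F K t)}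
  mul_mem' := by
    rintro f g ⟨N, P, hf⟩ ⟨N', P', hg⟩
    refine ⟨N + N', P * P', fun t => ?_⟩
    rw [Polynomial.eval_mul, ← hf, ← hg, Pi.mul_apply]
    ring
  add_mem' := by
    rintro f g ⟨N, P, hf⟩ ⟨N', P', hg⟩
    refine ⟨N + N', P * Polynomial.X ^ N' + P' * Polynomial.X ^ N, fun t => ?_⟩
    simp only [Polynomial.eval_add, Polynomial.eval_mul, Polynomial.eval_pow, Polynomial.eval_X]
    rw [← hf, ← hg, Pi.add_apply]
    ring
  algebraMap_mem' := fun a => ⟨0, Polynomial.C a, fun t => by simp⟩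

variable {F K}

theorem mem_laurentFunctions {f : Fˣ → K} : f ∈ laurentFunctions F K ↔
    ∃ (N : ℕ) (P : Polynomial K),
      ∀ t : Fˣ, algebraMap F K t ^ N * f t = P.eval (algebraMap F K t) := Iff.rfl

theorem eval_mem_laurentFunctions (P : Polynomial F) :
    (fun t : Fˣ => P.eval (t : F)) ∈ laurentFunctions F F := ⟨0, P, fun t => by simp⟩

theorem coe_inv_mem_laurentFunctions :
    (fun t : Fˣ => ((t⁻¹ : Fˣ) : F)) ∈ laurentFunctions F F := ⟨1, 1, fun t => by simp⟩

theorem coe_mem_laurentFunctions : (fun t : Fˣ => (t : F)) ∈ laurentFunctions F F := by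
  simpa using eval_mem_laurentFunctions (F := F) Polynomial.X

theorem algebraMap_comp_mem_laurentFunctions {f : Fˣ → F} (hf : f ∈ laurentFunctions F F) :
    (fun t => algebraMap F K (f t)) ∈ laurentFunctions F K := by
  obtain ⟨N, P, h⟩ := hf
  refine ⟨N, P.map (algebraMap F K), fun t => ?_⟩
  rw [Polynomial.eval_map_apply, ← map_pow, ← map_mul]
  congr 1
  exact h t

theorem eq_zero_of_infinite {f : Fˣ → K} (hf : f ∈ laurentFunctions F K)
    (h : {t | f t = 0}.Infinite) (t : Fˣ) : f t = 0 := by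
  obtain ⟨N, P, hP⟩ := hf
  have hinj : Function.Injective fun t : Fˣ => algebraMap F K t :=
    (algebraMap F K).injective.comp Units.val_injective
  have h0 : P = 0 := by
    refine Polynomial.eq_zero_of_infinite_isRoot P ((h.image hinj.injOn).mono ?_)
    rintro _ ⟨t, ht, rfl⟩
    have h1 := hP t
    rw [show f t = 0 from ht, mul_zero] at h1
    exact h1.symm
  have h1 := hP t
  rw [h0, Polynomial.eval_zero] at h1
  exact (mul_eq_zero.mp h1).resolve_left (pow_ne_zero _ (by simp))

theorem eq_zero_or_eq_zero_of_mul [Infinite F] {f g : Fˣ → K} (hf : f ∈ laurentFunctions F K)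
    (hg : g ∈ laurentFunctions F K) (h : ∀ t, f t * g t = 0) :
    (∀ t, f t = 0) ∨ ∀ t, g t = 0 := by
  have h1 : ({t | f t = 0} ∪ {t | g t = 0}).Infinite := by
    have : Infinite Fˣ := by
      have : Infinite {a : F // a ≠ 0} := (Set.finite_singleton (0 : F)).infinite_compl.to_subtype
      exact unitsEquivNeZero.infinite_iff.mpr this
    convert Set.infinite_univ (α := Fˣ)
    ext t
    simpa using h t
  exact (Set.infinite_union.mp h1).imp (eq_zero_of_infinite hf) (eq_zero_of_infinite hg)

theorem aeval_mem_laurentFunctions {k ι : Type*} [Field k] [Algebra k K] {x : ι → Fˣ → K}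
    (hx : ∀ c, x c ∈ laurentFunctions F K) (p : MvPolynomial ι k) :
    (fun t => MvPolynomial.aeval (fun c => x c t) p) ∈ laurentFunctions F K := by
  induction p using MvPolynomial.induction_on with
  | C a =>
    simp only [MvPolynomial.aeval_C]
    exact (laurentFunctions F K).algebraMap_mem (algebraMap k K a)
  | add p q hp hq =>
    simp only [map_add]
    exact add_mem hp hq
  | mul_X p i hp =>
    simp only [map_mul, MvPolynomial.aeval_X]
    exact mul_mem hp (hx i)

end LaurentFunctions

section LaurentCurves

variable {F L : Type*} [Field F] [Field L] [Algebra F L] {n : ℕ}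

/-- The entries of `γ t` and of its inverse are Laurent polynomials in `t`. -/
def IsLaurentCurve (γ : Fˣ → GL (Fin n) F) : Prop :=
  ∀ i j, (fun t => γ t i j) ∈ laurentFunctions F F ∧
    (fun t => (γ t)⁻¹ i j) ∈ laurentFunctions F F

theorem det_mem_laurentFunctions {X : Fˣ → Matrix (Fin n) (Fin n) F}
    (hX : ∀ i j, (fun t => X t i j) ∈ laurentFunctions F F) :
    (fun t => (X t).det) ∈ laurentFunctions F F := by
  have h : (fun t => (X t).det) =
      ∑ τ : Equiv.Perm (Fin n), (Equiv.Perm.sign τ : ℤ) • ∏ i, fun t => X t (τ i) i := by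
    funext t
    rw [Matrix.det_apply, Finset.sum_apply]
    refine Finset.sum_congr rfl fun τ _ => ?_
    rw [Pi.smul_apply, Finset.prod_apply]
    rfl
  rw [h]
  exact sum_mem fun τ _ => zsmul_mem (prod_mem fun i _ => hX _ _) _

namespace IsLaurentCurve

variable {γ δ : Fˣ → GL (Fin n) F}

theorem inv (hγ : IsLaurentCurve γ) : IsLaurentCurve fun t => (γ t)⁻¹ := fun i j =>
  ⟨(hγ i j).2, by simpa using (hγ i j).1⟩

theorem mul (hγ : IsLaurentCurve γ) (hδ : IsLaurentCurve δ) :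
    IsLaurentCurve fun t => γ t * δ t := by
  have key : ∀ X Y : Fˣ → Matrix (Fin n) (Fin n) F,
      (∀ i j, (fun t => X t i j) ∈ laurentFunctions F F) →
      (∀ i j, (fun t => Y t i j) ∈ laurentFunctions F F) →
      ∀ i j, (fun t => (X t * Y t) i j) ∈ laurentFunctions F F := by
    intro X Y hX hY i j
    have h : (fun t => (X t * Y t) i j) = ∑ k, (fun t => X t i k) * fun t => Y t k j := by
      funext t
      simp [Matrix.mul_apply]
    rw [h]
    exact sum_mem fun k _ => mul_mem (hX _ _) (hY _ _)
  refine fun i j => ⟨key _ _ (fun i j => (hγ i j).1) (fun i j => (hδ i j).1) i j, ?_⟩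
  simp only [_root_.mul_inv_rev]
  exact key _ _ (fun i j => (hδ i j).2) (fun i j => (hγ i j).2) i j

theorem const (g : GL (Fin n) F) : IsLaurentCurve fun _ : Fˣ => g := fun i j =>
  ⟨(laurentFunctions F F).algebraMap_mem (g i j), (laurentFunctions F F).algebraMap_mem (g⁻¹ i j)⟩

theorem coord_mem (hγ : IsLaurentCurve γ) (x : Option (Fin n × Fin n)) :
    (fun t => coord (γ t) x) ∈ laurentFunctions F F := by
  cases x with
  | some ij => exact (hγ ij.1 ij.2).1
  | none =>
    convert det_mem_laurentFunctions (fun i j => (hγ i j).2) using 2 with t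
    simp [coord, Matrix.coe_units_inv, Matrix.det_nonsing_inv, Ring.inverse_eq_inv']

theorem evalAt_mem {k : Type*} [Field k] [Algebra k L] (hγ : IsLaurentCurve γ)
    (p : MvPolynomial (Option (Fin n × Fin n)) k) :
    (fun t => evalAt (baseChange F L n (γ t)) p) ∈ laurentFunctions F L := by
  simp only [evalAt, coord_baseChange]
  exact aeval_mem_laurentFunctions
    (fun c => algebraMap_comp_mem_laurentFunctions (hγ.coord_mem c)) p

/-- A Zariski closed set containing infinitely many points of a curve contains the curve. -/
theorem mem_of_infinite {k : Type*} [Field k] [Algebra k L] (hγ : IsLaurentCurve γ)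
    {Z : Set (GL (Fin n) L)} (hZ : IsZariskiClosed k Z)
    (h : {t | baseChange F L n (γ t) ∈ Z}.Infinite) (t : Fˣ) : baseChange F L n (γ t) ∈ Z := by
  obtain ⟨I, rfl⟩ := hZ
  exact fun p hp => eq_zero_of_infinite (hγ.evalAt_mem p) (h.mono fun t ht => by exact ht p hp) t

/-- A curve in `K` starting in a closed and open subgroup of `K` stays in it, because the ring of
Laurent polynomials is a domain. -/
theorem mem_of_isOpenSubgroupOf [Infinite F] {k : Type*} [Field k] [Algebra k L]
    (hγ : IsLaurentCurve γ) {S T : Subgroup (GL (Fin n) L)}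
    (hS : IsZariskiClosed k (S : Set (GL (Fin n) L))) (hST : IsOpenSubgroupOf S T)
    (hT : ∀ t, baseChange F L n (γ t) ∈ T) (h1 : γ 1 = 1) (t : Fˣ) :
    baseChange F L n (γ t) ∈ S := by
  obtain ⟨-, Z, ⟨J, rfl⟩, hJ⟩ := hST
  obtain ⟨I, hI⟩ := hS
  have hmem : ∀ g, g ∈ S ↔ g ∈ T ∧ ∃ q ∈ J, evalAt g q ≠ 0 := by
    intro g
    have := Set.ext_iff.mp hJ g
    simpa using! this
  -- `q` vanishes on `T \ S` but not at `1`, so `p * q` vanishes on the curve for each equation `p`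
  -- of `S`
  obtain ⟨-, q, hq, hq1⟩ := (hmem 1).mp (one_mem S)
  change _ ∈ (S : Set (GL (Fin n) L))
  rw [hI]
  intro p hp
  refine (eq_zero_or_eq_zero_of_mul (hγ.evalAt_mem p) (hγ.evalAt_mem q) fun t => ?_).resolve_right
    (fun h => hq1 (by simpa [h1] using h 1)) t
  by_cases ht : baseChange F L n (γ t) ∈ S
  · change _ ∈ (S : Set (GL (Fin n) L)) at ht
    rw [hI] at ht
    rw [ht p hp, zero_mul]
  · have h2 : evalAt (baseChange F L n (γ t)) q = 0 := by
      by_contra h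
      exact ht ((hmem _).mpr ⟨hT t, q, hq, h⟩)
    rw [h2, mul_zero]

theorem eq_of_infinite (hγ : IsLaurentCurve γ) (hδ : IsLaurentCurve δ)
    (h : {t | γ t = δ t}.Infinite) (t : Fˣ) : γ t = δ t := by
  ext i j
  have := eq_zero_of_infinite (sub_mem (hγ i j).1 (hδ i j).1)
    (h.mono fun t (ht : γ t = δ t) => by simp [ht]) t
  simpa [sub_eq_zero] using this

theorem conjMatrix_mem (hγ : IsLaurentCurve γ) (Q : GL (Fin n) F) (i j : Fin n) :
    (fun t => conjMatrix Q (γ t) i j) ∈ laurentFunctions F F :=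
  ((((const Q).mul hγ).mul (const Q⁻¹)) i j).1

/-- The image of a curve by a morphism of algebraic groups. -/
theorem pointsMap {m : ℕ} {S : Subgroup (GL (Fin n) L)} {T : Subgroup (GL (Fin m) L)}
    {φ : S →* T} (hφ : IsRegularOver F φ) {γ : Fˣ → points F S}
    (hγ : IsLaurentCurve fun t => (γ t : GL (Fin n) F)) :
    IsLaurentCurve fun t => (RedSym.pointsMap φ hφ (γ t) : GL (Fin m) F) := by
  have key : ∀ γ : Fˣ → points F S, IsLaurentCurve (fun t => (γ t : GL (Fin n) F)) → ∀ i j,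
      (fun t => (RedSym.pointsMap φ hφ (γ t) : GL (Fin m) F) i j) ∈ laurentFunctions F F := by
    intro γ hγ i j
    obtain ⟨p, hp⟩ := id hφ
    convert hγ.evalAt_mem (L := F) (p i j) using 2 with t
    apply (algebraMap F L).injective
    have h := congrArg (fun g : GL (Fin m) L => g i j) (baseChange_pointsMap φ hφ (γ t))
    rw [hp, evalAt_baseChange] at h
    simp only [baseChange, Algebra.algebraMap_self, Matrix.GeneralLinearGroup.map_id]
    exact h
  refine fun i j => ⟨key γ hγ i j, ?_⟩
  have := key (fun t => (γ t)⁻¹) hγ.inv i j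
  simpa using this

end IsLaurentCurve

end LaurentCurves

/-! ### Simultaneous diagonalization of cocharacter values -/

section Diagonalization

variable {F : Type*} [Field F] {n : ℕ}

theorem IsLaurentCurve.exists_coefficients {γ : Fˣ → GL (Fin n) F} (hγ : IsLaurentCurve γ) :
    ∃ (N K : ℕ) (C : ℕ → Matrix (Fin n) (Fin n) F), ∀ t : Fˣ,
      (t : F) ^ N • (γ t : Matrix (Fin n) (Fin n) F) =
        ∑ k ∈ Finset.range K, (t : F) ^ k • C k := by
  choose N P hP using fun i j => mem_laurentFunctions.mp (hγ i j).1
  let N₀ : ℕ := ∑ i, ∑ j, N i j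
  have hN : ∀ i j, N i j ≤ N₀ := fun i j =>
    (Finset.single_le_sum (f := fun j => N i j) (fun _ _ => Nat.zero_le _)
      (Finset.mem_univ j)).trans
      (Finset.single_le_sum (f := fun i => ∑ j, N i j) (fun _ _ => Nat.zero_le _)
        (Finset.mem_univ i))
  let R : Fin n → Fin n → Polynomial F := fun i j => Polynomial.X ^ (N₀ - N i j) * P i j
  let K : ℕ := ∑ i, ∑ j, ((R i j).natDegree + 1)
  have hK : ∀ i j, (R i j).natDegree < K := fun i j =>
    (Finset.single_le_sum (f := fun j => (R i j).natDegree + 1) (fun _ _ => Nat.zero_le _)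
      (Finset.mem_univ j)).trans
      (Finset.single_le_sum (f := fun i => ∑ j, ((R i j).natDegree + 1))
        (fun _ _ => Nat.zero_le _) (Finset.mem_univ i))
  refine ⟨N₀, K, fun k => Matrix.of fun i j => (R i j).coeff k, fun t => ?_⟩
  ext i j
  have h1 := hP i j t
  simp only [Algebra.algebraMap_self, RingHom.id_apply] at h1
  have h2 := Polynomial.eval_eq_sum_range' (hK i j) (t : F)
  simp only [R, Polynomial.eval_mul, Polynomial.eval_pow, Polynomial.eval_X, ← h1] at h2
  simp only [Matrix.smul_apply, Matrix.sum_apply, Matrix.of_apply, smul_eq_mul]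
  rw [← Nat.sub_add_cancel (hN i j), pow_add, mul_assoc, h2]
  exact Finset.sum_congr rfl fun k _ => mul_comm _ _

variable [Infinite F]

theorem matrix_eq_zero_of_sum_pow_smul {K : ℕ} {A : ℕ → Matrix (Fin n) (Fin n) F}
    (h : ∀ t : Fˣ, ∑ k ∈ Finset.range K, (t : F) ^ k • A k = 0) {k : ℕ} (hk : k < K) : A k = 0 := by
  ext i j
  let P : Polynomial F := ∑ k ∈ Finset.range K, Polynomial.C (A k i j) * Polynomial.X ^ k
  have hP : ∀ t : F, t ≠ 0 → P.eval t = 0 := by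
    intro t ht
    have := congrFun (congrFun (h (Units.mk0 t ht)) i) j
    simp only [Units.val_mk0, Matrix.sum_apply, Matrix.smul_apply, smul_eq_mul,
      Matrix.zero_apply] at this
    simp only [P, Polynomial.eval_finsetSum, Polynomial.eval_mul, Polynomial.eval_C,
      Polynomial.eval_pow, Polynomial.eval_X]
    rw [← this]
    exact Finset.sum_congr rfl fun k _ => mul_comm _ _
  have h0 : P = 0 := Polynomial.eq_zero_of_infinite_isRoot P
    ((Set.finite_singleton (0 : F)).infinite_compl.mono fun t ht => hP t ht)
  have h1 : P.coeff k = A k i j := by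
    simp [P, Polynomial.finsetSum_coeff, Polynomial.coeff_C_mul, Polynomial.coeff_X_pow, hk]
  rw [← h1, h0, Polynomial.coeff_zero, Matrix.zero_apply]

/-- The weight decomposition for a cocharacter `c` of `GL_n`: the coefficients of `c` are
projections onto its weight spaces. -/
theorem exists_weight_decomposition (c : Fˣ →* GL (Fin n) F) (hc : IsLaurentCurve c) :
    ∃ (K : ℕ) (C : ℕ → Matrix (Fin n) (Fin n) F) (a : ℕ → ℤ),
      ∑ k ∈ Finset.range K, C k = 1 ∧
      (∀ k ∈ Finset.range K, ∀ s : Fˣ,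
        (c s : Matrix (Fin n) (Fin n) F) * C k = ((s ^ a k : Fˣ) : F) • C k) ∧
      ∀ X : Matrix (Fin n) (Fin n) F, (∀ t, Commute X (c t : Matrix (Fin n) (Fin n) F)) →
        ∀ k ∈ Finset.range K, Commute X (C k) := by
  obtain ⟨N, K, C, hC⟩ := hc.exists_coefficients
  refine ⟨K, C, fun k => k - N, ?_, fun k hk s => ?_, fun X hX k hk => ?_⟩
  · simpa using (hC 1).symm
  -- compare the coefficients in `t` of `c s * c t = c (s * t)`
  · refine sub_eq_zero.mp (matrix_eq_zero_of_sum_pow_smul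
      (A := fun k => (c s : Matrix (Fin n) (Fin n) F) * C k - ((s ^ ((k : ℤ) - N) : Fˣ) : F) • C k)
      (fun t => ?_) (Finset.mem_range.mp hk))
    have h1 : ∑ k ∈ Finset.range K, (t : F) ^ k • ((c s : Matrix (Fin n) (Fin n) F) * C k) =
        (t : F) ^ N • ((c s : Matrix (Fin n) (Fin n) F) * (c t : Matrix (Fin n) (Fin n) F)) := by
      rw [← Matrix.mul_smul, hC t, Finset.mul_sum]
      exact Finset.sum_congr rfl fun k _ => (Matrix.mul_smul _ _ _).symm
    have h2 : ∑ k ∈ Finset.range K, (t : F) ^ k • (((s ^ ((k : ℤ) - N) : Fˣ) : F) • C k) =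
        ((s ^ (-N : ℤ) : Fˣ) : F) • ∑ k ∈ Finset.range K, ((s * t : Fˣ) : F) ^ k • C k := by
      rw [Finset.smul_sum]
      refine Finset.sum_congr rfl fun k _ => ?_
      rw [smul_smul, smul_smul, ← Units.val_pow_eq_pow_val, ← Units.val_pow_eq_pow_val,
        ← Units.val_mul, ← Units.val_mul]
      congr 2
      rw [mul_pow, sub_eq_add_neg, _root_.zpow_add, zpow_natCast]
      rw [← mul_assoc, mul_comm (t ^ k), mul_comm (s ^ (-N : ℤ))]
    simp only [smul_sub, Finset.sum_sub_distrib]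
    rw [h1, h2, ← hC (s * t), map_mul, Units.val_mul, smul_smul, sub_eq_zero]
    congr 1
    rw [← Units.val_mul s t, ← Units.val_pow_eq_pow_val, ← Units.val_pow_eq_pow_val,
      ← Units.val_mul, mul_pow, ← mul_assoc, _root_.zpow_neg, zpow_natCast, inv_mul_cancel, one_mul]
  · refine sub_eq_zero.mp (matrix_eq_zero_of_sum_pow_smul
      (A := fun k => X * C k - C k * X) (fun t => ?_) (Finset.mem_range.mp hk))
    simp only [smul_sub, Finset.sum_sub_distrib]
    simp only [← Matrix.mul_smul X, ← Matrix.smul_mul _ _ X, ← Finset.mul_sum, ← Finset.sum_mul]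
    rw [← hC t, Matrix.mul_smul, Matrix.smul_mul, (hX t).eq, sub_self]

theorem exists_isDiagonalizedBy (ϖ : Fˣ) (c d : Fˣ →* GL (Fin n) F) (hc : IsLaurentCurve c)
    (hd : IsLaurentCurve d) (hcd : ∀ s t, Commute (c s) (d t)) :
    ∃ (Q : GL (Fin n) F) (w w' : Fin n → ℤ),
      IsDiagonalizedBy ϖ Q w (c ϖ) ∧ IsDiagonalizedBy ϖ Q w' (d ϖ) := by
  obtain ⟨K, C, a, hC1, hC, hCX⟩ := exists_weight_decomposition c hc
  obtain ⟨K', D, b, hD1, hD, -⟩ := exists_weight_decomposition d hd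
  -- the joint eigenvectors span, as the images of the `C i * D j` consist of joint eigenvectors
  let S : Set (Fin n → F) := {v | ∃ a b : ℤ,
    (c ϖ : Matrix (Fin n) (Fin n) F) *ᵥ v = ((ϖ ^ a : Fˣ) : F) • v ∧
    (d ϖ : Matrix (Fin n) (Fin n) F) *ᵥ v = ((ϖ ^ b : Fˣ) : F) • v}
  have hS : ⊤ ≤ Submodule.span F S := by
    intro v _
    have hv : v = ∑ i ∈ Finset.range K, ∑ j ∈ Finset.range K', (C i * D j) *ᵥ v := by
      simp only [← Matrix.sum_mulVec, ← Finset.mul_sum, hD1, mul_one, hC1, Matrix.one_mulVec]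
    rw [hv]
    refine sum_mem fun i hi => sum_mem fun j hj => Submodule.subset_span ⟨a i, b j, ?_, ?_⟩
    · rw [Matrix.mulVec_mulVec, ← mul_assoc, hC i hi, Matrix.smul_mul, Matrix.smul_mulVec]
    · have h1 : Commute (d ϖ : Matrix (Fin n) (Fin n) F) (C i) := by
        refine hCX _ (fun t => ?_) i hi
        have := congrArg (fun g : GL (Fin n) F => (g : Matrix (Fin n) (Fin n) F)) (hcd t ϖ).symm.eq
        exact this
      rw [Matrix.mulVec_mulVec, ← mul_assoc, h1.eq, mul_assoc, hD j hj, Matrix.mul_smul,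
        Matrix.smul_mulVec]
  let B := Module.Basis.ofSpan hS
  let e := B.indexEquiv (Pi.basisFun F (Fin n))
  let B' : Module.Basis (Fin n) F (Fin n → F) := B.reindex e
  have hB : ∀ i, B' i ∈ S := by
    intro i
    apply Module.Basis.ofSpan_subset hS
    rw [Module.Basis.reindex_apply]
    exact ⟨_, rfl⟩
  choose w w' hw hw' using hB
  let R : Matrix (Fin n) (Fin n) F := (Pi.basisFun F (Fin n)).toMatrix B'
  let R' : Matrix (Fin n) (Fin n) F := B'.toMatrix (Pi.basisFun F (Fin n))
  let Q : GL (Fin n) F := ⟨R', R, Module.Basis.toMatrix_mul_toMatrix_flip _ _,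
    Module.Basis.toMatrix_mul_toMatrix_flip _ _⟩
  have key : ∀ (g : GL (Fin n) F) (u : Fin n → ℤ),
      (∀ i, (g : Matrix (Fin n) (Fin n) F) *ᵥ B' i = ((ϖ ^ u i : Fˣ) : F) • B' i) →
      IsDiagonalizedBy ϖ Q u g := by
    intro g u hu
    have h1 : (g : Matrix (Fin n) (Fin n) F) * R =
        R * Matrix.diagonal fun i => ((ϖ ^ u i : Fˣ) : F) := by
      ext i j
      rw [Matrix.mul_diagonal]
      have := congrFun (hu j) i
      rw [Pi.smul_apply, smul_eq_mul, mul_comm] at this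
      exact this
    change R' * (g : Matrix (Fin n) (Fin n) F) * R = _
    have h2 : R' * R = 1 := Module.Basis.toMatrix_mul_toMatrix_flip _ _
    rw [mul_assoc, h1, ← mul_assoc, h2, one_mul]
  exact ⟨Q, w, w', key _ _ hw, key _ _ hw'⟩

end Diagonalization

/-! ### Powers of unipotent elements -/

section Unipotent

variable {F : Type*} [Field F] [CharZero F] {n : ℕ}

/-- The parameters `m + 1`, for `m : ℕ`, are infinitely many, hence Zariski dense. They are shifted
by one because zero is not in `Fˣ`. -/
theorem infinite_of_forall_natCast {p : Fˣ → Prop}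
    (h : ∀ (m : ℕ) (t : Fˣ), (t : F) = m + 1 → p t) : {t | p t}.Infinite := by
  refine (Set.infinite_range_of_injective
    (f := fun m : ℕ => Units.mk0 ((m : F) + 1) (Nat.cast_add_one_ne_zero m)) ?_).mono ?_
  · intro a b hab
    simpa using congrArg (Units.val) hab
  · rintro _ ⟨m, rfl⟩
    exact h m _ rfl

/-- The binomial coefficient `x.choose k` as a polynomial in `x`. -/
noncomputable def binomialPolynomial (F : Type*) [Field F] (k : ℕ) : Polynomial F :=
  Polynomial.C (k.factorial : F)⁻¹ * descPochhammer F k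

theorem binomialPolynomial_eval_natCast (k m : ℕ) :
    (binomialPolynomial F k).eval (m : F) = m.choose k := by
  rw [binomialPolynomial, Polynomial.eval_mul, Polynomial.eval_C,
    descPochhammer_eval_eq_descFactorial, Nat.descFactorial_eq_factorial_mul_choose,
    Nat.cast_mul, inv_mul_cancel_left₀ (Nat.cast_ne_zero.mpr k.factorial_ne_zero)]

/-- The binomial series `(1 + N) ^ t` truncated at order `d`, as a matrix of polynomials in `t`. -/
noncomputable def binomialSeries (N : Matrix (Fin n) (Fin n) F) (d : ℕ) (i j : Fin n) : Polynomial F :=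
  ∑ k ∈ Finset.range d, Polynomial.C ((N ^ k) i j) * binomialPolynomial F k

theorem binomialSeries_eval_natCast {N : Matrix (Fin n) (Fin n) F} {d : ℕ} (hN : N ^ d = 0)
    (m : ℕ) (i j : Fin n) : (binomialSeries N d i j).eval (m : F) = ((1 + N) ^ m) i j := by
  rw [add_comm, (Commute.one_right N).add_pow', Finset.Nat.sum_antidiagonal_eq_sum_range_succ_mk]
  simp only [one_pow, mul_one, Matrix.sum_apply, binomialSeries, Polynomial.eval_finsetSum,
    Polynomial.eval_mul, Polynomial.eval_C, binomialPolynomial_eval_natCast, Matrix.smul_apply]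
  have h1 : ∀ k, d ≤ k → N ^ k = 0 := fun k hk => pow_eq_zero_of_le hk hN
  rw [Finset.sum_subset (Finset.range_subset_range.mpr (le_max_left d (m + 1))),
    Finset.sum_subset (Finset.range_subset_range.mpr (le_max_right d (m + 1)))]
  · exact Finset.sum_congr rfl fun k _ => by rw [nsmul_eq_mul, mul_comm]
  · intro k _ hk
    rw [Finset.mem_range] at hk
    rw [Nat.choose_eq_zero_of_lt (by omega)]
    simp
  · intro k _ hk
    rw [Finset.mem_range] at hk
    rw [h1 k (by omega)]
    simp

theorem polynomial_ext_natCast {P R : Polynomial F}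
    (h : ∀ m : ℕ, P.eval (m : F) = R.eval (m : F)) : P = R :=
  Polynomial.eq_of_infinite_eval_eq P R
    ((Set.infinite_range_of_injective Nat.cast_injective).mono (by rintro _ ⟨m, rfl⟩; exact h m))

/-- The binomial series is additive in the exponent, as it is so for natural exponents. -/
theorem binomialSeries_add {N : Matrix (Fin n) (Fin n) F} {d : ℕ} (hN : N ^ d = 0) (s t : F)
    (i j : Fin n) : (binomialSeries N d i j).eval (s + t) =
      ∑ k, (binomialSeries N d i k).eval s * (binomialSeries N d k j).eval t := by
  have key : ∀ (m : ℕ) (t : F), (binomialSeries N d i j).eval ((m : F) + t) =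
      ∑ k, (binomialSeries N d i k).eval (m : F) * (binomialSeries N d k j).eval t := by
    intro m t
    have := polynomial_ext_natCast
      (P := (binomialSeries N d i j).comp (Polynomial.C (m : F) + Polynomial.X))
      (R := ∑ k, Polynomial.C ((binomialSeries N d i k).eval (m : F)) * binomialSeries N d k j)
      fun m' => by
        simp only [Polynomial.eval_comp, Polynomial.eval_add, Polynomial.eval_C,
          Polynomial.eval_X, Polynomial.eval_finsetSum, Polynomial.eval_mul]
        rw [← Nat.cast_add]
        simp only [binomialSeries_eval_natCast hN, pow_add, Matrix.mul_apply]
    simpa [Polynomial.eval_finsetSum] using congrArg (Polynomial.eval t) this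
  have := polynomial_ext_natCast
      (P := (binomialSeries N d i j).comp (Polynomial.X + Polynomial.C t))
      (R := ∑ k, binomialSeries N d i k * Polynomial.C ((binomialSeries N d k j).eval t))
      fun m => by
        simpa [Polynomial.eval_finsetSum] using key m t
  simpa [Polynomial.eval_finsetSum] using congrArg (Polynomial.eval s) this

/-- The powers `g ^ (t - 1)` of a unipotent element form a curve. The exponent is shifted for
the curve, which is parametrized by `Fˣ`, to pass through `1` and `g`; the square root of `g` is
its value at `3 / 2`. -/
theorem exists_power_curve {g : GL (Fin n) F}
    (hg : IsNilpotent ((g : Matrix (Fin n) (Fin n) F) - 1)) :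
    ∃ γ : Fˣ → GL (Fin n) F, IsLaurentCurve γ ∧
      (∀ (m : ℕ) (t : Fˣ), (t : F) = m + 1 → γ t = g ^ m) ∧ ∃ r : Fˣ, γ r * γ r = g := by
  obtain ⟨d, hd⟩ := hg
  set N := (g : Matrix (Fin n) (Fin n) F) - 1 with hN
  let E : F → Matrix (Fin n) (Fin n) F := fun t => Matrix.of fun i j =>
    (binomialSeries N d i j).eval t
  have hE : ∀ m : ℕ, E m = (g : Matrix (Fin n) (Fin n) F) ^ m := by
    intro m
    ext i j
    have h : 1 + N = (g : Matrix (Fin n) (Fin n) F) := by rw [hN, add_sub_cancel]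
    rw [← h]
    exact binomialSeries_eval_natCast hd m i j
  have hadd : ∀ s t, E (s + t) = E s * E t := by
    intro s t
    ext i j
    simp [E, Matrix.mul_apply, binomialSeries_add hd]
  have h0 : E 0 = 1 := by simpa using hE 0
  let φ : F → GL (Fin n) F := fun t =>
    ⟨E t, E (-t), by rw [← hadd, add_neg_cancel, h0], by rw [← hadd, neg_add_cancel, h0]⟩
  have h3 : (3 / 2 : F) ≠ 0 := by norm_num
  refine ⟨fun t => φ ((t : F) - 1), fun i j => ⟨?_, ?_⟩, fun m t ht => ?_, Units.mk0 _ h3, ?_⟩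
  · convert eval_mem_laurentFunctions ((binomialSeries N d i j).comp (Polynomial.X - 1)) using 2
      with t
    simp [φ, E]
  · convert eval_mem_laurentFunctions ((binomialSeries N d i j).comp (1 - Polynomial.X)) using 2
      with t
    change (binomialSeries N d i j).eval (-((t : F) - 1)) = _
    simp
  · apply Units.ext
    have : (t : F) - 1 = m := by rw [ht, add_sub_cancel_right]
    change E ((t : F) - 1) = _
    rw [this, hE, Units.val_pow_eq_pow_val]
  · apply Units.ext
    change E _ * E _ = _
    rw [← hadd]
    have : ((Units.mk0 (3 / 2 : F) h3 : Fˣ) : F) - 1 + (((Units.mk0 (3 / 2 : F) h3 : Fˣ) : F) - 1) =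
        ((1 : ℕ) : F) := by norm_num
    rw [this, hE, pow_one]

variable [TopologicalSpace F] [IsTopologicalRing F] [T2Space F]

/-- The characteristic polynomial is invariant under conjugation and continuous, so an element that
can be contracted to `1` by conjugation is unipotent. -/
theorem isNilpotent_sub_one_of_mem_unipRadOf {G : Subgroup (GL (Fin n) F)} {l g : G}
    (hg : g ∈ unipRadOf l) :
    IsNilpotent (((g : GL (Fin n) F) : Matrix (Fin n) (Fin n) F) - 1) := by
  have h1 : ((g : GL (Fin n) F) : Matrix (Fin n) (Fin n) F).charpoly =
      (1 : Matrix (Fin n) (Fin n) F).charpoly := by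
    refine Polynomial.funext fun x => ?_
    rw [Matrix.eval_charpoly, Matrix.eval_charpoly]
    have hcont : Continuous fun y : G =>
        (Matrix.scalar (Fin n) x - ((y : GL (Fin n) F) : Matrix (Fin n) (Fin n) F)).det :=
      (continuous_const.sub (Units.continuous_val.comp continuous_subtype_val)).matrix_det
    have h2 := (hcont.tendsto 1).comp hg
    simp only [OneMemClass.coe_one, Units.val_one] at h2
    refine tendsto_nhds_unique (tendsto_const_nhds.congr fun k => ?_) h2
    let a : GL (Fin n) F := (l : GL (Fin n) F) ^ k
    let A : Matrix (Fin n) (Fin n) F := a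
    let A' : Matrix (Fin n) (Fin n) F := (a⁻¹ : GL (Fin n) F)
    have hA : A' * A = 1 := a.inv_mul
    have h3 : Matrix.scalar (Fin n) x - A' * (g : GL (Fin n) F) * A =
        A' * (Matrix.scalar (Fin n) x - (g : GL (Fin n) F)) * A := by
      rw [mul_sub, sub_mul, ← (Matrix.scalar_commute x (Commute.all x) A').eq, mul_assoc _ A' A,
        hA, mul_one]
    change _ = (Matrix.scalar (Fin n) x - A' * (g : GL (Fin n) F) * A).det
    rw [h3, Matrix.det_mul, Matrix.det_mul, mul_right_comm, ← Matrix.det_mul, hA,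
      Matrix.det_one, one_mul]
  refine ⟨n, ?_⟩
  have h2 := Matrix.aeval_self_charpoly ((g : GL (Fin n) F) : Matrix (Fin n) (Fin n) F)
  rw [h1, Matrix.charpoly_one] at h2
  simpa using h2

end Unipotent

/-! ### Groups of points -/

section Points

variable {F L : Type*} [Field F] [Field L] [Algebra F L] {n : ℕ}

theorem mul_comm_of_isSplitTorus {A : Subgroup (GL (Fin n) L)} (hA : IsSplitTorus F A)
    {a b : GL (Fin n) L} (ha : a ∈ A) (hb : b ∈ A) : a * b = b * a := by
  obtain ⟨-, r, e, -, -⟩ := hA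
  have hcomm : ∀ x y : diagTorus L r, x * y = y * x := by
    rintro ⟨x, hx⟩ ⟨y, hy⟩
    apply Subtype.ext
    apply Units.ext
    change (x : Matrix (Fin r) (Fin r) L) * y = y * x
    rw [← (Matrix.isDiag_iff_diagonal_diag _).mp hx, ← (Matrix.isDiag_iff_diagonal_diag _).mp hy,
      Matrix.diagonal_mul_diagonal, Matrix.diagonal_mul_diagonal]
    simp only [mul_comm]
  have h : (⟨a, ha⟩ * ⟨b, hb⟩ : A) = ⟨b, hb⟩ * ⟨a, ha⟩ := by
    apply e.symm.injective
    rw [map_mul, map_mul, hcomm]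
  exact congrArg Subtype.val h

theorem mul_comm_of_mem_points {A : Subgroup (GL (Fin n) L)} (hA : IsSplitTorus F A)
    {a b : GL (Fin n) F} (ha : a ∈ points F A) (hb : b ∈ points F A) : a * b = b * a := by
  apply baseChange_injective (F := F) (L := L) n
  rw [map_mul, map_mul]
  exact mul_comm_of_isSplitTorus hA ha hb

/-- The values on `Fˣ` of a one-parameter subgroup form a Laurent polynomial curve. -/
theorem exists_cocharacter {A : Subgroup (GL (Fin n) L)} {ϖ : Fˣ} {l : GL (Fin n) F}
    (hl : l ∈ cocharacterValues L ϖ A) :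
    ∃ c : Fˣ →* points F A, IsLaurentCurve (fun t => (c t : GL (Fin n) F)) ∧ c ϖ = l := by
  obtain ⟨c, hc, hcl⟩ := hl
  let S : Fˣ →* points F (⊤ : Subgroup (GL (Fin 1) L)) :=
    { toFun := fun t => ⟨Matrix.GeneralLinearGroup.scalar (Fin 1) t, Subgroup.mem_top _⟩
      map_one' := Subtype.ext (map_one _)
      map_mul' := fun a b => Subtype.ext (map_mul _ a b) }
  have hS : IsLaurentCurve (fun t => (S t : GL (Fin 1) F)) := by
    intro i j
    obtain rfl := Subsingleton.elim i 0
    obtain rfl := Subsingleton.elim j 0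
    refine ⟨?_, ?_⟩
    · convert coe_mem_laurentFunctions (F := F) using 2 with t
      simp [S]
    · convert coe_inv_mem_laurentFunctions (F := F) using 2 with t
      rw [← Subgroup.coe_inv, ← map_inv]
      simp [S]
  refine ⟨(pointsMap c hc).comp S, hS.pointsMap hc, ?_⟩
  apply baseChange_injective (F := F) (L := L) n
  rw [hcl]
  exact baseChange_pointsMap c hc (S ϖ)

section Topology

variable [TopologicalSpace F] [IsTopologicalRing F]

theorem continuous_evalAt (p : MvPolynomial (Option (Fin n × Fin n)) F) :
    Continuous fun g : GL (Fin n) F => evalAt g p := by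
  have h : Continuous fun g : GL (Fin n) F => coord g := by
    refine continuous_pi fun x => ?_
    cases x with
    | some ij => exact Units.continuous_val.matrix_elem ij.1 ij.2
    | none =>
      have h1 : Continuous fun g : GL (Fin n) F =>
          ((g⁻¹ : GL (Fin n) F) : Matrix (Fin n) (Fin n) F).det :=
        Units.continuous_coe_inv.matrix_det
      refine h1.congr fun g => ?_
      simp [coord, Matrix.coe_units_inv, Matrix.det_nonsing_inv, Ring.inverse_eq_inv']
  exact (MvPolynomial.continuous_eval p).comp h

theorem isClosed_points [T2Space F] {S : Subgroup (GL (Fin n) L)}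
    (hS : IsZariskiClosed F (S : Set (GL (Fin n) L))) :
    IsClosed (points F S : Set (GL (Fin n) F)) := by
  obtain ⟨I, hI⟩ := hS
  have h : (points F S : Set (GL (Fin n) F)) = ⋂ p ∈ I, {g | evalAt g p = 0} := by
    ext g
    change baseChange F L n g ∈ (S : Set (GL (Fin n) L)) ↔ _
    rw [hI]
    simp [evalAt_baseChange]
  rw [h]
  exact isClosed_biInter fun p _ => isClosed_eq (continuous_evalAt p) continuous_const

theorem continuous_pointsMap {m : ℕ} {S : Subgroup (GL (Fin n) L)} {T : Subgroup (GL (Fin m) L)}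
    (φ : S →* T) (hφ : IsRegularOver F φ) : Continuous (pointsMap φ hφ) := by
  have key : Continuous fun g : points F S =>
      ((pointsMap φ hφ g : GL (Fin m) F) : Matrix (Fin m) (Fin m) F) := by
    obtain ⟨p, hp⟩ := id hφ
    refine continuous_pi fun i => continuous_pi fun j => ?_
    refine ((continuous_evalAt (p i j)).comp continuous_subtype_val).congr fun g => ?_
    apply (algebraMap F L).injective
    have h := congrArg (fun g : GL (Fin m) L => g i j) (baseChange_pointsMap φ hφ g)
    rw [hp, evalAt_baseChange] at h
    exact h.symm
  refine Continuous.subtype_mk (f := fun g => (pointsMap φ hφ g : GL (Fin m) F))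
    (Units.continuous_iff.mpr ⟨key, ?_⟩) _
  refine (key.comp continuous_inv).congr fun g => ?_
  simp

end Topology

/-- A unipotent element of `G` lies on a curve in `G` through its natural powers and its square
root. -/
theorem exists_power_curve_points [CharZero F] {S : Subgroup (GL (Fin n) L)}
    (hS : IsZariskiClosed F (S : Set (GL (Fin n) L))) {g : points F S}
    (hg : IsNilpotent (((g : GL (Fin n) F) : Matrix (Fin n) (Fin n) F) - 1)) :
    ∃ γ : Fˣ → points F S, IsLaurentCurve (fun t => (γ t : GL (Fin n) F)) ∧
      (∀ (m : ℕ) (t : Fˣ), (t : F) = m + 1 → γ t = g ^ m) ∧ ∃ r : Fˣ, γ r * γ r = g := by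
  obtain ⟨γ, hγ, hpow, r, hr⟩ := exists_power_curve hg
  have hmem : ∀ t, γ t ∈ points F S := by
    refine fun t => hγ.mem_of_infinite hS (infinite_of_forall_natCast fun m t ht => ?_) t
    rw [hpow m t ht]
    exact (g ^ m).2
  exact ⟨fun t => ⟨γ t, hmem t⟩, hγ, fun m t ht => Subtype.ext (hpow m t ht), r, Subtype.ext hr⟩

theorem mem_unipRadOf_of_infinite [TopologicalSpace F] [IsTopologicalRing F] [T2Space F]
    {ϖ : Fˣ} {G : Subgroup (GL (Fin n) F)} {Q : GL (Fin n) F} {w : Fin n → ℤ} {l : G}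
    (hϖ : Tendsto (fun k : ℕ => (ϖ : F) ^ k) atTop (𝓝 0)) (hG : IsClosed (G : Set (GL (Fin n) F)))
    (hl : IsDiagonalizedBy ϖ Q w (l : GL (Fin n) F)) {γ : Fˣ → G}
    (hγ : IsLaurentCurve fun t => (γ t : GL (Fin n) F)) (h : {t | γ t ∈ unipRadOf l}.Infinite)
    (t : Fˣ) : γ t ∈ unipRadOf l := by
  simp only [mem_unipRadOf_iff hϖ hG hl] at h ⊢
  refine ⟨fun i j hij => ⟨?_, ?_⟩, fun i j hij => ?_⟩
  · exact eq_zero_of_infinite (hγ.conjMatrix_mem Q i j) (h.mono fun t ht => (ht.1 i j hij).1) t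
  · exact eq_zero_of_infinite (hγ.inv.conjMatrix_mem Q i j) (h.mono fun t ht => (ht.1 i j hij).2) t
  · refine sub_eq_zero.mp (eq_zero_of_infinite (sub_mem (hγ.conjMatrix_mem Q i j)
      ((laurentFunctions F F).algebraMap_mem ((1 : Matrix (Fin n) (Fin n) F) i j)))
      (h.mono fun t ht => ?_) t)
    exact sub_eq_zero.mpr (ht.2 i j hij)

end Points

/-! ### Images under an involution -/

section Involution

variable {Γ : Type*} [Group Γ] {σ : Γ →* Γ}

theorem map_eq_of_forall_mem (hinv : Function.Involutive σ) {S T : Subgroup Γ}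
    (h : ∀ g ∈ S, σ g ∈ T) (h' : ∀ g ∈ T, σ g ∈ S) : S.map σ = T := by
  refine le_antisymm (Subgroup.map_le_iff_le_comap.mpr h) fun g hg => ⟨σ g, h' g hg, hinv g⟩

theorem map_conj_pow (l g : Γ) (k : ℕ) :
    σ ((l ^ k)⁻¹ * g * l ^ k) = (σ l ^ k)⁻¹ * σ g * σ l ^ k := by
  simp

theorem map_leviOf (hinv : Function.Involutive σ) (l : Γ) : (leviOf l).map σ = leviOf (σ l) := by
  have key : ∀ l, ∀ g ∈ leviOf l, σ g ∈ leviOf (σ l) := by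
    intro l g hg
    change (σ l)⁻¹ * σ g * σ l = σ g
    rw [← map_inv, ← map_mul, ← map_mul]
    exact congrArg σ hg
  refine map_eq_of_forall_mem hinv (key l) ?_
  simpa only [hinv l] using key (σ l)

variable [TopologicalSpace Γ] [IsTopologicalGroup Γ]

theorem map_parabolicOf (hinv : Function.Involutive σ) (hσ : Continuous σ) (l : Γ) :
    (parabolicOf l).map σ = parabolicOf (σ l) := by
  have key : ∀ l, ∀ g ∈ parabolicOf l, σ g ∈ parabolicOf (σ l) := by
    rintro l g ⟨C, hC, hg⟩
    refine ⟨σ '' C, hC.image hσ, fun k => ?_⟩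
    rw [← map_conj_pow]
    exact Set.mem_image_of_mem σ (hg k)
  refine map_eq_of_forall_mem hinv (key l) ?_
  simpa only [hinv l] using key (σ l)

theorem map_unipRadOf (hinv : Function.Involutive σ) (hσ : Continuous σ) (l : Γ) :
    (unipRadOf l).map σ = unipRadOf (σ l) := by
  have key : ∀ l, ∀ g ∈ unipRadOf l, σ g ∈ unipRadOf (σ l) := by
    intro l g hg
    have h := (hσ.tendsto 1).comp hg
    rw [map_one] at h
    exact h.congr fun k => map_conj_pow l g k
  refine map_eq_of_forall_mem hinv (key l) ?_
  simpa only [hinv l] using key (σ l)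

end Involution

/-! ### Descent to the fixed points of the involution -/

section FixedPoints

variable {F L : Type*} [Field F] [Field L] [Algebra F L] {n : ℕ}
  {GG HH : Subgroup (GL (Fin n) L)} {s : GG →* GG}

theorem mem_fixedSubgroup_iff (hs : IsRegularOver F s) (g : points F GG) :
    baseChange F L n g ∈ fixedSubgroup s ↔ pointsMap s hs g = g := by
  have h1 : pointsMap s hs g = g ↔ s ⟨baseChange F L n g, g.2⟩ = ⟨baseChange F L n g, g.2⟩ := by
    rw [← Subtype.coe_inj, ← Subtype.coe_inj, ← baseChange_pointsMap s hs g]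
    exact (baseChange_injective n).eq_iff.symm
  rw [h1]
  constructor
  · rintro ⟨x, hx, hxg⟩
    obtain rfl : x = ⟨baseChange F L n g, g.2⟩ := Subtype.ext hxg
    exact hx
  · exact fun h => ⟨_, h, rfl⟩

variable [CharZero F]

/-- A unipotent element fixed by the involution lies in every open subgroup of the fixed points,
being joined to `1` by the curve of its powers. -/
theorem mem_of_isNilpotent_of_fixed (hs : IsRegularOver F s)
    (hG : IsZariskiClosed F (GG : Set (GL (Fin n) L)))
    (hH : IsZariskiClosed F (HH : Set (GL (Fin n) L)))
    (hH_open : IsOpenSubgroupOf HH (fixedSubgroup s)) {h : points F GG}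
    (hu : IsNilpotent (((h : GL (Fin n) F) : Matrix (Fin n) (Fin n) F) - 1))
    (hfix : pointsMap s hs h = h) : (h : GL (Fin n) F) ∈ points F HH := by
  obtain ⟨γ, hγ, hpow, -⟩ := exists_power_curve_points hG hu
  have h1 : γ 1 = 1 := by simpa using hpow 0 1 (by simp)
  have h2 : γ (Units.mk0 2 two_ne_zero) = h := by
    simpa using hpow 1 (Units.mk0 2 two_ne_zero) (by norm_num)
  have hfixγ : ∀ t, pointsMap s hs (γ t) = γ t := fun t => by
    refine Subtype.ext ((hγ.pointsMap hs).eq_of_infinite hγ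
      (infinite_of_forall_natCast fun m t ht => ?_) t)
    rw [hpow m t ht, map_pow, hfix]
  rw [← h2]
  exact hγ.mem_of_isOpenSubgroupOf hH hH_open
    (fun t => (mem_fixedSubgroup_iff hs (γ t)).mpr (hfixγ t)) (by rw [h1]; rfl) _

/-- For a cocharacter `c` with values commuting with those of its image by the involution,
`t ↦ c t * σ (c t)` is a cocharacter of the group of fixed points. -/
theorem mul_pointsMap_mem (hs : IsRegularOver F s) (hinv : Function.Involutive (pointsMap s hs))
    (hH : IsZariskiClosed F (HH : Set (GL (Fin n) L)))
    (hH_open : IsOpenSubgroupOf HH (fixedSubgroup s)) (c : Fˣ →* points F GG)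
    (hc : IsLaurentCurve fun t => (c t : GL (Fin n) F))
    (hcomm : ∀ t, Commute (c t) (pointsMap s hs (c t))) (t : Fˣ) :
    ((c t * pointsMap s hs (c t) : points F GG) : GL (Fin n) F) ∈ points F HH := by
  refine (hc.mul (hc.pointsMap hs)).mem_of_isOpenSubgroupOf hH hH_open (fun t => ?_) (by simp) t
  refine (mem_fixedSubgroup_iff hs (c t * pointsMap s hs (c t))).mpr ?_
  rw [map_mul, hinv, (hcomm t).eq]

/-- The first cohomology of an involution of a unipotent group is trivial: an element `w` with
`σ w = w⁻¹` has the form `u * (σ u)⁻¹`, where `u` is the square root of `w`. -/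
theorem exists_sqrt [TopologicalSpace F] [IsTopologicalRing F] [T2Space F] {ϖ : Fˣ}
    (hϖ : Tendsto (fun k : ℕ => (ϖ : F) ^ k) atTop (𝓝 0)) (hs : IsRegularOver F s)
    (hG : IsZariskiClosed F (GG : Set (GL (Fin n) L))) {Q : GL (Fin n) F} {w w' : Fin n → ℤ}
    {l l' g : points F GG} (hl : IsDiagonalizedBy ϖ Q w (l : GL (Fin n) F))
    (hl' : IsDiagonalizedBy ϖ Q w' (l' : GL (Fin n) F)) (hg : g ∈ unipRadOf l ⊓ unipRadOf l')
    (hσ : pointsMap s hs g = g⁻¹) :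
    ∃ u ∈ unipRadOf l ⊓ unipRadOf l', pointsMap s hs u = u⁻¹ ∧ u * u = g := by
  obtain ⟨γ, hγ, hpow, r, hr⟩ := exists_power_curve_points hG
    (isNilpotent_sub_one_of_mem_unipRadOf hg.1)
  have hcl := isClosed_points hG
  refine ⟨γ r, ⟨?_, ?_⟩, ?_, hr⟩
  · refine mem_unipRadOf_of_infinite hϖ hcl hl hγ (infinite_of_forall_natCast fun m t ht => ?_) r
    rw [hpow m t ht]
    exact pow_mem hg.1 m
  · refine mem_unipRadOf_of_infinite hϖ hcl hl' hγ (infinite_of_forall_natCast fun m t ht => ?_) r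
    rw [hpow m t ht]
    exact pow_mem hg.2 m
  · refine Subtype.ext ((hγ.pointsMap hs).eq_of_infinite hγ.inv
      (infinite_of_forall_natCast fun m t ht => ?_) r)
    rw [hpow m t ht, map_pow, hσ, inv_pow]
    rfl

end FixedPoints

theorem conj_mem_of_isNormalIn {Γ : Type*} [Group Γ] {N K : Subgroup Γ} (h : IsNormalIn N K)
    {g v : Γ} (hg : g ∈ K) (hv : v ∈ N) : g * v * g⁻¹ ∈ N :=
  Subgroup.mem_subgroupOf.mp (h.2.conj_mem ⟨v, h.1 hv⟩ hv ⟨g, hg⟩)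

/-- The map `V' → V' / N` stays surjective on fixed points, where `N` plays the role of `U ∩ σ(P)`
and every `w` in `N ∩ σ(N)` with `σ w = w⁻¹` has a suitable square root: the product `x * σ x` is
fixed up to the commutator `w` of `x` and `σ x`, and multiplying by the square root of `w` makes it
fixed. -/
theorem exists_fixed_mul {Γ : Type*} [Group Γ] {σ : Γ →* Γ} (hinv : Function.Involutive σ)
    {V' N W : Subgroup Γ} (hN : IsNormalIn N V') (hW : W ≤ N)
    (hNW : ∀ g ∈ N, σ g ∈ N → g ∈ W)
    (hsqrt : ∀ w ∈ W, σ w = w⁻¹ → ∃ u ∈ W, σ u = u⁻¹ ∧ u * u = w)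
    {x : Γ} (hx : x ∈ V') (hσx : σ x ∈ N) :
    ∃ h ∈ V', σ h = h ∧ ∃ y ∈ N, x = h * y := by
  set z := σ x with hz
  have hσz : σ z = x := hinv x
  have hw : z⁻¹ * x⁻¹ * z * x ∈ N := by
    have := conj_mem_of_isNormalIn hN (inv_mem hx) hσx
    rw [inv_inv] at this
    simpa only [mul_assoc] using mul_mem (inv_mem hσx) this
  have hσw : σ (z⁻¹ * x⁻¹ * z * x) = (z⁻¹ * x⁻¹ * z * x)⁻¹ := by
    simp only [map_mul, map_inv, hσz, ← hz]
    group
  obtain ⟨u, hu, hσu, huu⟩ := hsqrt _ (hNW _ hw (by rw [hσw]; exact inv_mem hw)) hσw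
  refine ⟨x * z * u, mul_mem (mul_mem hx (hN.1 hσx)) (hN.1 (hW hu)), ?_, u⁻¹ * z⁻¹,
    mul_mem (inv_mem (hW hu)) (inv_mem hσx), by group⟩
  rw [map_mul, map_mul, hσz, ← hz, hσu]
  have h1 : u * u * u⁻¹ = u := by group
  calc z * x * u⁻¹ = x * z * (z⁻¹ * x⁻¹ * z * x) * u⁻¹ := by group
    _ = x * z * u := by rw [← huu, mul_assoc (x * z), h1]

end RedSym

theorem proposition8
    {F : Type*} [Field F] [ValuativeRel F] [TopologicalSpace F] [IsNonarchimedeanLocalField F]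
    [CharZero F] (ϖ : Fˣ) (hϖ : RedSym.IsUniformizer ϖ)
    {n : ℕ}
    -- `GG` is a connected reductive linear algebraic group defined over `F`
    (GG : Subgroup (GL (Fin n) (AlgebraicClosure F)))
    (hG_closed : RedSym.IsZariskiClosed F (GG : Set (GL (Fin n) (AlgebraicClosure F))))
    (hG_conn : RedSym.IsZariskiConnected (GG : Set (GL (Fin n) (AlgebraicClosure F))))
    (hG_red : RedSym.IsReductive GG)
    -- `s` is an involution of `GG` defined over `F`
    (s : GG →* GG) (hs_reg : RedSym.IsRegularOver F s) (hs_inv : Function.Involutive s)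
    -- `HH` is an open subgroup, defined over `F`, of the group of fixed points of `s`
    (HH : Subgroup (GL (Fin n) (AlgebraicClosure F)))
    (hH_closed : RedSym.IsZariskiClosed F (HH : Set (GL (Fin n) (AlgebraicClosure F))))
    (hH_open : RedSym.IsOpenSubgroupOf HH (RedSym.fixedSubgroup s))
    -- `AA` is a maximal split torus of `GG`
    (AA : Subgroup (GL (Fin n) (AlgebraicClosure F)))
    (hA : RedSym.IsMaximalSplitTorus F AA GG)
    -- the involution `σ` induced on `G = GG(F)`, and the subgroups `H = HH(F)`, `A = AA(F)` of `G`
    (σ : RedSym.points F GG →* RedSym.points F GG) (hσ : σ = RedSym.pointsMap s hs_reg)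
    (H : Subgroup (RedSym.points F GG))
    (hH : H = (RedSym.points F HH).subgroupOf (RedSym.points F GG))
    (A : Subgroup (RedSym.points F GG))
    (hA_points : A = (RedSym.points F AA).subgroupOf (RedSym.points F GG))
    -- `A` is `σ`-stable
    (hA_stable : A.map σ = A)
    -- `l` is an element of the lattice `Λ(A)`
    (l : RedSym.points F GG)
    (hl : (l : GL (Fin n) F) ∈ RedSym.cocharacterValues (AlgebraicClosure F) ϖ AA)
    -- `P = P_l = M U`, `V` is the unipotent radical of `P_μ` where `μ = l σ(l)`
    (P M U V V' : Subgroup (RedSym.points F GG))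
    (hP : P = RedSym.parabolicOf l) (hM : M = RedSym.leviOf l) (hU : U = RedSym.unipRadOf l)
    (hV : V = RedSym.unipRadOf (l * σ l))
    (hV' : V' = (P ⊓ P.map σ) ⊓ V) :
    -- (i)
    (((P ⊓ P.map σ : Subgroup _) : Set (RedSym.points F GG)) =
        ((M ⊓ M.map σ : Subgroup _) : Set (RedSym.points F GG)) * (V' : Set (RedSym.points F GG)) ∧
      RedSym.IsNormalIn V' (P ⊓ P.map σ) ∧
      V' ⊓ (M ⊓ M.map σ) = ⊥) ∧
    -- (ii)
    ((V' : Set (RedSym.points F GG)) =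
        ((M ⊓ U.map σ : Subgroup _) : Set (RedSym.points F GG)) *
          ((U ⊓ P.map σ : Subgroup _) : Set (RedSym.points F GG)) ∧
      ((U ⊓ P.map σ : Subgroup _) : Set (RedSym.points F GG)) =
        ((U ⊓ M.map σ : Subgroup _) : Set (RedSym.points F GG)) *
          ((U ⊓ U.map σ : Subgroup _) : Set (RedSym.points F GG)) ∧
      RedSym.IsNormalIn (U ⊓ P.map σ) V' ∧
      RedSym.IsNormalIn (U ⊓ U.map σ) (U ⊓ P.map σ)) ∧
    -- (iii)
    (((P ⊓ H : Subgroup _) : Set (RedSym.points F GG)) =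
        ((M ⊓ M.map σ ⊓ H : Subgroup _) : Set (RedSym.points F GG)) *
          ((V' ⊓ H : Subgroup _) : Set (RedSym.points F GG)) ∧
      RedSym.IsNormalIn (V' ⊓ H) (P ⊓ H)) ∧
    -- (iv)
    (∀ x ∈ M ⊓ U.map σ, ∃ h ∈ H ⊓ V', ∃ y ∈ U ⊓ P.map σ, x = h * y) := by
  subst hP hM hU hV
  have := RedSym.t2Space_of_isNonarchimedeanLocalField F
  have hϖ0 := hϖ.tendsto_pow
  have hcl := RedSym.isClosed_points hG_closed
  have hcont : Continuous σ := by rw [hσ]; exact RedSym.continuous_pointsMap s hs_reg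
  have hinv : Function.Involutive σ := by
    intro g
    apply Subtype.ext
    apply RedSym.baseChange_injective (F := F) (L := AlgebraicClosure F) n
    rw [hσ, RedSym.baseChange_pointsMap]
    have h1 : (⟨RedSym.baseChange F (AlgebraicClosure F) n (RedSym.pointsMap s hs_reg g),
        (RedSym.pointsMap s hs_reg g).2⟩ : GG) =
        s ⟨RedSym.baseChange F (AlgebraicClosure F) n g, g.2⟩ :=
      Subtype.ext (RedSym.baseChange_pointsMap s hs_reg g)
    rw [h1, hs_inv]
  -- `l` and `σ l` are values of commuting cocharacters, so one basis diagonalizes both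
  obtain ⟨c₀, hc₀, hc₀l⟩ := RedSym.exists_cocharacter hl
  have hle : RedSym.points F AA ≤ RedSym.points F GG := Subgroup.comap_mono hA.2.1
  let c : Fˣ →* RedSym.points F GG := (Subgroup.inclusion hle).comp c₀
  have hc : RedSym.IsLaurentCurve fun t => (c t : GL (Fin n) F) := hc₀
  have hcl' : c ϖ = l := Subtype.ext hc₀l
  have hcA : ∀ t, c t ∈ A := fun t => by rw [hA_points]; exact (c₀ t).2
  have hσA : ∀ a ∈ A, σ a ∈ A := fun a ha => by
    rw [← hA_stable]
    exact Subgroup.mem_map_of_mem σ ha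
  have hAcomm : ∀ a ∈ A, ∀ b ∈ A, Commute a b := by
    intro a ha b hb
    rw [hA_points] at ha hb
    exact Subtype.ext (RedSym.mul_comm_of_mem_points hA.1 ha hb)
  obtain ⟨Q, w, w', hlw, hlw'⟩ := RedSym.exists_isDiagonalizedBy ϖ
    ((RedSym.points F GG).subtype.comp c) ((RedSym.points F GG).subtype.comp (σ.comp c)) hc
    (by subst hσ; exact hc.pointsMap hs_reg)
    (fun t t' => congrArg Subtype.val (hAcomm _ (hcA t) _ (hσA _ (hcA t'))).eq)
  replace hlw : RedSym.IsDiagonalizedBy ϖ Q w (l : GL (Fin n) F) := by rw [← hcl']; exact hlw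
  replace hlw' : RedSym.IsDiagonalizedBy ϖ Q w' (σ l : GL (Fin n) F) := by rw [← hcl']; exact hlw'
  have hmulw : RedSym.IsDiagonalizedBy ϖ Q (w + w')
      ((l * σ l : RedSym.points F GG) : GL (Fin n) F) :=
    hlw.mul hlw'
  rw [RedSym.map_parabolicOf hinv hcont, RedSym.map_leviOf hinv,
    RedSym.map_unipRadOf hinv hcont] at *
  set l' := σ l with hl'
  have hPP := RedSym.parabolicOf_inf_le hϖ0 hcl hlw hlw'
  have hMPP := RedSym.leviOf_mul_inf_parabolicOf hϖ0 hcl hlw hlw'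
  have hMV := RedSym.leviOf_inf_unipRadOf_mul hϖ0 hcl hlw hlw'
  have hUV := RedSym.unipRadOf_inf_unipRadOf_mul hϖ0 hcl hlw hlw'
  rw [← hV'] at hMV hUV
  -- the limits under conjugation by the powers of `l * l'`, of `l` and of `l'`
  have hlim₁ : ∀ g ∈ RedSym.parabolicOf l ⊓ RedSym.parabolicOf l',
      ∃ m ∈ RedSym.parabolicOf l ⊓ RedSym.parabolicOf l',
        Tendsto (fun k : ℕ => ((l * l') ^ k)⁻¹ * g * (l * l') ^ k) atTop (𝓝 m) := by
    intro g hg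
    obtain ⟨m, hm, h⟩ := RedSym.exists_tendsto_of_mem_parabolicOf hϖ0 hcl hmulw (hPP hg)
    exact ⟨m, ⟨(h l w hlw).1 hg.1, (h l' w' hlw').1 hg.2⟩, hm⟩
  have hlim₂ : ∀ g ∈ V', ∃ m ∈ V', Tendsto (fun k : ℕ => (l ^ k)⁻¹ * g * l ^ k) atTop (𝓝 m) := by
    intro g hg
    rw [hV'] at hg ⊢
    obtain ⟨m, hm, h⟩ := RedSym.exists_tendsto_of_mem_parabolicOf hϖ0 hcl hlw hg.1.1
    exact ⟨m, ⟨⟨(h l w hlw).1 hg.1.1, (h l' w' hlw').1 hg.1.2⟩, (h _ _ hmulw).2 hg.2⟩, hm⟩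
  have hlim₃ : ∀ g ∈ RedSym.unipRadOf l ⊓ RedSym.parabolicOf l',
      ∃ m ∈ RedSym.unipRadOf l ⊓ RedSym.parabolicOf l',
        Tendsto (fun k : ℕ => (l' ^ k)⁻¹ * g * l' ^ k) atTop (𝓝 m) := by
    intro g hg
    obtain ⟨m, hm, h⟩ := RedSym.exists_tendsto_of_mem_parabolicOf hϖ0 hcl hlw' hg.2
    exact ⟨m, ⟨(h l w hlw).2 hg.1, (h l' w' hlw').1 hg.2⟩, hm⟩
  have hfix : ∀ h ∈ H, σ h = h := by
    intro h hh
    rw [hH] at hh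
    rw [hσ]
    exact (RedSym.mem_fixedSubgroup_iff hs_reg h).mp (hH_open.1 hh)
  have hPH : RedSym.parabolicOf l ⊓ H ≤ RedSym.parabolicOf l ⊓ RedSym.parabolicOf l' := by
    intro g hg
    refine ⟨hg.1, ?_⟩
    rw [hl', ← RedSym.map_parabolicOf hinv hcont]
    exact ⟨g, hg.1, hfix g hg.2⟩
  have hμ : l * l' ∈ H := by
    rw [hH, hl', ← hcl', hσ]
    refine RedSym.mul_pointsMap_mem hs_reg (hσ ▸ hinv) hH_closed hH_open c hc (fun t => ?_) ϖ
    rw [← hσ]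
    exact hAcomm _ (hcA t) _ (hσA _ (hcA t))
  have hHcl : IsClosed (H : Set (RedSym.points F GG)) := by
    rw [hH]
    exact (RedSym.isClosed_points hH_closed).preimage continuous_subtype_val
  have hlim₄ : ∀ g ∈ RedSym.parabolicOf l ⊓ H, ∃ m ∈ RedSym.parabolicOf l ⊓ H,
      Tendsto (fun k : ℕ => ((l * l') ^ k)⁻¹ * g * (l * l') ^ k) atTop (𝓝 m) := by
    intro g hg
    obtain ⟨m, hm, hm'⟩ := hlim₁ g (hPH hg)
    refine ⟨m, ⟨hm.1, hHcl.mem_of_tendsto hm' (Eventually.of_forall fun k => ?_)⟩, hm'⟩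
    exact H.mul_mem (H.mul_mem (H.inv_mem (H.pow_mem hμ k)) hg.2) (H.pow_mem hμ k)
  have hd₁ := RedSym.levi_decomposition hlim₁
  have hd₂ := RedSym.levi_decomposition hlim₂
  have hd₃ := RedSym.levi_decomposition hlim₃
  have hd₄ := RedSym.levi_decomposition hlim₄
  rw [hMPP, inf_comm (RedSym.unipRadOf _), ← hV'] at hd₁
  rw [hMV, hUV] at hd₂
  have e₁ : RedSym.leviOf l' ⊓ (RedSym.unipRadOf l ⊓ RedSym.parabolicOf l') =
      RedSym.unipRadOf l ⊓ RedSym.leviOf l' := by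
    rw [inf_left_comm, inf_eq_left.mpr (RedSym.leviOf_le_parabolicOf l')]
  have e₂ : RedSym.unipRadOf l' ⊓ (RedSym.unipRadOf l ⊓ RedSym.parabolicOf l') =
      RedSym.unipRadOf l ⊓ RedSym.unipRadOf l' := by
    rw [inf_left_comm, inf_eq_left.mpr (RedSym.unipRadOf_le_parabolicOf l')]
  rw [e₁, e₂] at hd₃
  have e₃ : RedSym.leviOf (l * l') ⊓ (RedSym.parabolicOf l ⊓ H) =
      RedSym.leviOf l ⊓ RedSym.leviOf l' ⊓ H := by
    rw [← hMPP, inf_assoc, inf_right_comm _ _ H, inf_eq_left.mpr (hPH.trans inf_le_right)]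
  have e₄ : RedSym.unipRadOf (l * l') ⊓ (RedSym.parabolicOf l ⊓ H) = V' ⊓ H := by
    rw [hV', inf_right_comm _ _ H, inf_right_comm _ _ H,
      inf_eq_left.mpr (hPH.trans inf_le_right), inf_comm]
  rw [e₃, e₄] at hd₄
  refine ⟨⟨hd₁.1, hd₁.2, ?_⟩, ⟨hd₂.1, hd₃.1, hd₂.2, hd₃.2⟩, hd₄, fun x hx => ?_⟩
  · rw [eq_bot_iff, ← RedSym.leviOf_inf_unipRadOf (l * l'), ← hMPP, hV']
    exact fun g hg => ⟨hg.2.1, hg.1.2⟩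
  · have hσU : ∀ g ∈ RedSym.unipRadOf l', σ g ∈ RedSym.unipRadOf l := by
      intro g hg
      have h := Subgroup.mem_map_of_mem σ hg
      rwa [RedSym.map_unipRadOf hinv hcont, hl', hinv l] at h
    have hσU' : ∀ g, σ g ∈ RedSym.unipRadOf l → g ∈ RedSym.unipRadOf l' := by
      intro g hg
      have h := Subgroup.mem_map_of_mem σ hg
      rwa [RedSym.map_unipRadOf hinv hcont, hinv g] at h
    have hxV' : x ∈ V' := by
      rw [← hMV] at hx
      exact hx.2
    have hσx : σ x ∈ RedSym.unipRadOf l ⊓ RedSym.parabolicOf l' := by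
      refine ⟨hσU x hx.2, ?_⟩
      rw [hl', ← RedSym.map_parabolicOf hinv hcont]
      exact ⟨x, RedSym.leviOf_le_parabolicOf l hx.1, rfl⟩
    obtain ⟨h, hhV', hσh, y, hy, hxy⟩ := RedSym.exists_fixed_mul hinv hd₂.2
      (W := RedSym.unipRadOf l ⊓ RedSym.unipRadOf l') hd₃.2.1
      (fun g hg hσg => ⟨hg.1, hσU' g hσg.1⟩)
      (fun g hg hσg => by
        subst hσ
        exact RedSym.exists_sqrt hϖ0 hs_reg hG_closed hlw hlw' hg hσg) hxV' hσx
    have hhV := hhV'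
    rw [hV'] at hhV
    refine ⟨h, ⟨?_, hhV'⟩, y, hy, hxy⟩
    rw [hH]
    exact RedSym.mem_of_isNilpotent_of_fixed hs_reg hG_closed hH_closed hH_open
      (RedSym.isNilpotent_sub_one_of_mem_unipRadOf hhV.2) (by rw [← hσ]; exact hσh)
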